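/- Let $\mathbb K\in\{\mathbb R,\mathbb C\}$. Lie groups are groups which are smooth manifolds modelled on Hausdorff locally convex $\mathbb K$-spaces with smooth multiplication and inversion; a map $f$ is $C^1$ if it is continuous and its directional derivatives exist and define a continuous map $(x,h)\mapsto df(x)(h)$, it is $C^{n+1}$ if it is $C^1$ and $df$ is $C^n$, and smooth if it is $C^n$ for all $n$. A subgroup $H$ of a Lie group $P$ is a split Lie subgroup if it carries a Lie group structure and $P/H$ a manifold structure for which $P\to P/H$ is a (locally trivial) smooth $H$-principal bundle. A Lie group extension of $G$ by $N$ is a short exact sequence $1\to N\to\widehat G\to G\to 1$ of Lie group morphisms which is a smooth $N$-principal bundle over $G$; two extensions are equivalent if there is a Lie group morphism between them inducing the identity on $N$ and on $G$. Let $G,N$ be Lie groups. Let $C^p_s(G,N)$ be the set of maps $G^p\to N$ which are smooth in an identity neighbourhood and take the value $1$ whenever one argument is $1$, and let $C^2_{ss}(G,N)$ be the set of those $\omega\in C^2_s(G,N)$ for which, for every $g\in G$, the map $x\mapsto\omega(g,x)\,\omega(gxg^{-1},g)^{-1}$ is smooth in an identity neighbourhood. Write $C_N(n)(m)=nmn^{-1}$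 and $\delta_f(g,g')=f(g)f(g')f(gg')^{-1}$. A smooth outer action of $G$ on $N$ is a map $S:G\to\mathrm{Aut}(N)$ into the group of Lie group automorphisms, with $S(1)=\mathrm{id}_N$, such that $(g,n)\mapsto S(g)(n)$ is smooth on $U\times N$ for an open identity neighbourhood $U\subseteq G$, and such that $\delta_S=C_N\circ\omega$ for some $\omega\in C^2_s(G,N)$; it is strongly smooth if $\omega$ can be chosen in $C^2_{ss}(G,N)$. Put $S\sim S'$ if $S'=(C_N\circ h)\cdot S$ for some $h\in C^1_s(G,N)$; $[S]$ denotes the class of $S$. A smooth crossed module is a Lie group morphism $\alpha:H\to P$ with a smooth action of $P$ on $H$ by automorphisms such that $\alpha(p.h)=p\,\alpha(h)\,p^{-1}$ and $\alpha(h).h'=hh'h^{-1}$, such that $\ker\alpha\le H$ and $\operatorname{im}\alpha\le P$ are split Lie subgroups and $\alpha$ induces an isomorphism of Lie groups $H/\ker\alpha\to\operatorname{im}\alpha$. **Lemma.** Assume that the center $Z(N)$ is a split Lie subgroup of $N$, and let $S$ be a strongly smooth outer action of $G$ on $N$. Then $N_{\rm ad}:=N/Z(N)$, whose elements we write as $C_N(n)$,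 is a Lie group with the quotient manifold structure, and $G^S:=N_{\rm ad}\times G$ is a group with the product $$(C_N(n),g)(C_N(n'),g')=\big(C_N(n\,S(g)(n')\,\omega(g,g')),\,gg'\big),$$ which is the same for all $\omega:G\times G\to N$ with $\delta_S=C_N\circ\omega$. Moreover: 1. $G^S$ carries a Lie group structure, unique up to the identity being a diffeomorphism, for which, for some open identity neighbourhood $U\subseteq G$, the set $N_{\rm ad}\times U$ is open in $G^S$ and carries the product manifold structure. With it, $q_S:G^S\to G$, $(C_N(n),g)\mapsto g$, is a Lie group extension of $G$ by $N_{\rm ad}$ (included by $a\mapsto(a,1)$). The equivalence class of this extension depends only on $[S]$: every smooth outer action $S'\sim S$ is strongly smooth, and $G^{S'}$ and $G^S$ are equivalent extensions of $G$ by $N_{\rm ad}$. 2. $\rho:G^S\to\mathrm{Aut}(N)$, $\rho(C_N(n),g)=C_N(n)S(g)$, is a homomorphism defining a smooth action of $G^S$ on $N$. 3. $\alpha:N\to G^S$, $n\mapsto(C_N(n),1)$, with the action $\rho$, is a smooth crossed module with $\ker\alpha=Z(N)$ and image $N_{\rm ad}\times\{1\}$, and $q_S$ induces an isomorphism of Lie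 groups $\operatorname{coker}\alpha=G^S/N_{\rm ad}\cong G$. The map $S$ is the corresponding strongly smooth outer action of $G$ on $N$: there is a section $\sigma\in C^1_s(G,G^S)$ of $q_S$ with $\rho\circ\sigma=S$, and an $\omega\in C^2_{ss}(G,N)$ with $\alpha\circ\omega=\delta_\sigma$ and $\delta_S=C_N\circ\omega$. -/

import Mathlib

open Filter Topology Set

universe u₁ u₂ u₃ u₄ v

/-! ## Differential calculus on locally convex spaces -/

/-- `CnOn 𝕜 n f U`: the map `f` between topological vector spaces is of class `C^n` on the open
set `U`. It is `C^0` if it is continuous, and `C^(n+1)` if it is continuous, all directional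
derivatives `df(x)(h) = lim_{t → 0} t⁻¹ (f (x + t h) - f x)`, for `x` in `U`, exist, and the map
`(x, h) ↦ df(x)(h)` is of class `C^n` on `U × E`. -/
def CnOn (𝕜 : Type u₁) [RCLike 𝕜] : ℕ → ∀ {E : Type u₂} {F : Type u₃}
    [AddCommGroup E] [Module 𝕜 E] [TopologicalSpace E]
    [AddCommGroup F] [Module 𝕜 F] [TopologicalSpace F], (E → F) → Set E → Prop
  | 0, _, _, _, _, _, _, _, _, f, U => ContinuousOn f U
  | n + 1, E, F, _, _, _, _, _, _, f, U =>
      ContinuousOn f U ∧ ∃ df : E × E → F,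
        (∀ x ∈ U, ∀ h : E,
          Tendsto (fun t : 𝕜 => t⁻¹ • (f (x + t • h) - f x)) (𝓝[≠] 0) (𝓝 (df (x, h)))) ∧
        CnOn 𝕜 n df (U ×ˢ univ)

section Calculus

variable {𝕜 : Type u₁} [RCLike 𝕜]
  {E : Type u₂} [AddCommGroup E] [Module 𝕜 E] [TopologicalSpace E]
  {F : Type u₃} [AddCommGroup F] [Module 𝕜 F] [TopologicalSpace F]

theorem CnOn.continuousOn {n : ℕ} {f : E → F} {U : Set E} (h : CnOn 𝕜 n f U) :
    ContinuousOn f U := by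
  cases n with
  | zero => exact h
  | succ n => exact h.1

theorem CnOn.mono {n : ℕ} {f : E → F} {U V : Set E} (h : CnOn 𝕜 n f U) (hVU : V ⊆ U) :
    CnOn 𝕜 n f V := by
  induction n generalizing E F with
  | zero => exact ContinuousOn.mono h hVU
  | succ n ih =>
    obtain ⟨hc, df, hd, hs⟩ := h
    exact ⟨hc.mono hVU, df, fun x hx => hd x (hVU hx), ih hs (prod_mono hVU subset_rfl)⟩

theorem CnOn.comp_linear {E' : Type u₄} [AddCommGroup E'] [Module 𝕜 E'] [TopologicalSpace E']
    {n : ℕ} {f : E → F} {U : Set E} (h : CnOn 𝕜 n f U) (L : E' →L[𝕜] E) :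
    CnOn 𝕜 n (fun x => f (L x)) (L ⁻¹' U) := by
  induction n generalizing E E' F with
  | zero => exact ContinuousOn.comp h L.continuous.continuousOn (mapsTo_preimage _ _)
  | succ n ih =>
    obtain ⟨hc, df, hd, hs⟩ := h
    refine ⟨hc.comp L.continuous.continuousOn (mapsTo_preimage _ _),
      fun p => df (L p.1, L p.2), fun x hx k => ?_, ?_⟩
    · simpa using hd (L x) hx (L k)
    · refine (ih hs (L.prodMap L)).mono ?_
      rintro ⟨x, k⟩ ⟨hx, -⟩
      exact ⟨hx, mem_univ _⟩

theorem CnOn.prodMk {F' : Type u₄} [AddCommGroup F'] [Module 𝕜 F'] [TopologicalSpace F']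
    {n : ℕ} {f : E → F} {g : E → F'} {U : Set E} (hf : CnOn 𝕜 n f U) (hg : CnOn 𝕜 n g U) :
    CnOn 𝕜 n (fun x => (f x, g x)) U := by
  induction n generalizing E F F' with
  | zero => exact ContinuousOn.prodMk hf hg
  | succ n ih =>
    obtain ⟨hc, df, hd, hs⟩ := hf
    obtain ⟨hc', dg, hd', hs'⟩ := hg
    exact ⟨hc.prodMk hc', fun p => (df p, dg p),
      fun x hx k => (hd x hx k).prodMk_nhds (hd' x hx k), ih hs hs'⟩

end Calculus

/-- `f` is smooth on the open set `U`, i.e. of class `C^n` on `U` for all `n`. -/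
def SmoothOnOpen (𝕜 : Type u₁) [RCLike 𝕜] {E : Type u₂} {F : Type u₃}
    [AddCommGroup E] [Module 𝕜 E] [TopologicalSpace E]
    [AddCommGroup F] [Module 𝕜 F] [TopologicalSpace F] (f : E → F) (U : Set E) : Prop :=
  ∀ n : ℕ, CnOn 𝕜 n f U

/-! ## Manifolds modelled on locally convex spaces -/

/-- A smooth manifold structure on the set `M`: a Hausdorff topology together with an atlas of
charts with values in a Hausdorff locally convex space over `𝕜`, with smooth chart changes. -/
structure LCManifold (𝕜 : Type u₁) [RCLike 𝕜] (M : Type u₂) where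
  /-- the locally convex model space -/
  Model : Type v
  [addCommGroup : AddCommGroup Model]
  [module : Module 𝕜 Model]
  [modelTop : TopologicalSpace Model]
  [topAddGroup : IsTopologicalAddGroup Model]
  [continuousSMul : ContinuousSMul 𝕜 Model]
  [modelT2 : T2Space Model]
  [locallyConvex : PolynormableSpace 𝕜 Model]
  [top : TopologicalSpace M]
  [t2 : T2Space M]
  [charted : ChartedSpace Model M]
  smooth_change : ∀ e ∈ atlas Model M, ∀ e' ∈ atlas Model M,
    SmoothOnOpen 𝕜 (fun x => e' (e.symm x)) (e.symm.trans e').source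

attribute [instance] LCManifold.addCommGroup LCManifold.module LCManifold.modelTop
  LCManifold.topAddGroup LCManifold.continuousSMul LCManifold.modelT2 LCManifold.locallyConvex

namespace LCManifold

variable {𝕜 : Type u₁} [RCLike 𝕜]

/-- Openness in the topology of the manifold. -/
def IsOpenSet {M : Type u₂} (A : LCManifold.{u₁, u₂, v} 𝕜 M) (U : Set M) : Prop :=
  letI := A.top
  IsOpen U

/-- `f` is smooth on the open subset `U` of `M`: it is continuous there, and smooth in charts. -/
def SmoothOn {M : Type u₂} {M' : Type u₃} (A : LCManifold.{u₁, u₂, v} 𝕜 M)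
    (B : LCManifold.{u₁, u₃, v} 𝕜 M') (f : M → M') (U : Set M) : Prop :=
  letI := A.top
  letI := B.top
  letI := A.charted
  letI := B.charted
  ContinuousOn f U ∧ ∀ e ∈ atlas A.Model M, ∀ e' ∈ atlas B.Model M',
    SmoothOnOpen 𝕜 (fun x => e' (f (e.symm x)))
      (e.target ∩ e.symm ⁻¹' (U ∩ f ⁻¹' e'.source))

/-- Smooth maps between manifolds. -/
def Smooth {M : Type u₂} {M' : Type u₃} (A : LCManifold.{u₁, u₂, v} 𝕜 M)
    (B : LCManifold.{u₁, u₃, v} 𝕜 M') (f : M → M') : Prop :=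
  A.SmoothOn B f univ

/-- The bijection `e` is a diffeomorphism. -/
def Diffeo {M : Type u₂} {M' : Type u₃} (A : LCManifold.{u₁, u₂, v} 𝕜 M)
    (B : LCManifold.{u₁, u₃, v} 𝕜 M') (e : M ≃ M') : Prop :=
  A.Smooth B e ∧ B.Smooth A e.symm

/-- The product manifold. -/
def prod {M : Type u₂} {M' : Type u₃} (A : LCManifold.{u₁, u₂, v} 𝕜 M)
    (B : LCManifold.{u₁, u₃, v} 𝕜 M') : LCManifold.{u₁, max u₂ u₃, v} 𝕜 (M × M') :=
  letI := A.top
  letI := B.top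
  letI := A.t2
  letI := B.t2
  letI := A.charted
  letI := B.charted
  { Model := A.Model × B.Model
    charted := prodChartedSpace A.Model M B.Model M'
    smooth_change := by
      rintro _ ⟨a, ha, b, hb, rfl⟩ _ ⟨a', ha', b', hb', rfl⟩ n
      have h₁ := (A.smooth_change a ha a' ha' n).comp_linear
        (ContinuousLinearMap.fst 𝕜 A.Model B.Model)
      have h₂ := (B.smooth_change b hb b' hb' n).comp_linear
        (ContinuousLinearMap.snd 𝕜 A.Model B.Model)
      refine (h₁.mono ?_).prodMk (h₂.mono ?_)
      · rintro ⟨x, y⟩ ⟨hx, hx'⟩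
        exact ⟨hx.1, hx'.1⟩
      · rintro ⟨x, y⟩ ⟨hx, hx'⟩
        exact ⟨hx.2, hx'.2⟩ }

/-- The manifold structure turns the group `G` into a Lie group. -/
structure IsLieGroup {G : Type u₂} [Group G] (A : LCManifold.{u₁, u₂, v} 𝕜 G) : Prop where
  smooth_mul : (A.prod A).Smooth A (fun p => p.1 * p.2)
  smooth_inv : A.Smooth A (fun x => x⁻¹)

end LCManifold

section LieGroups

variable {𝕜 : Type u₁} [RCLike 𝕜]

/-! ## Split Lie subgroups and extensions -/

/-- For a homomorphism `i : H → P`, the right action `p.h = p * i h` of the Lie group `H` on `P`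
makes `π : P → X` a smooth `H`-principal bundle: `i` and `π` are smooth, the action is free, its
orbits are the fibres of `π`, and `π` is locally trivial: over small open sets `V` there is a smooth
section `s`, and the inverse `p ↦ (π p, d p)` of the trivialization `(x, h) ↦ s x * i h` of
`π ⁻¹ V` is smooth. -/
structure IsPrincipalBundle {H : Type u₂} [Group H] {P : Type u₃} [Group P] {X : Type u₄}
    (A : LCManifold.{u₁, u₂, v} 𝕜 H) (B : LCManifold.{u₁, u₃, v} 𝕜 P)
    (C : LCManifold.{u₁, u₄, v} 𝕜 X) (i : H →* P) (π : P → X) : Prop where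
  smooth_incl : A.Smooth B i
  smooth_proj : B.Smooth C π
  free : Function.Injective i
  fiber : ∀ p p' : P, π p = π p' ↔ ∃ h : H, p' = p * i h
  locally_trivial : ∀ x : X, ∃ V : Set X, C.IsOpenSet V ∧ x ∈ V ∧
    ∃ s : X → P, C.SmoothOn B s V ∧ (∀ y ∈ V, π (s y) = y) ∧
    ∃ d : P → H, B.SmoothOn A d (π ⁻¹' V) ∧ ∀ p : P, π p ∈ V → p = s (π p) * i (d p)

/-- The data making the subgroup `H` of the Lie group `G` a split Lie subgroup: a Lie group
structure on `H` and a manifold structure on the coset space `G ⧸ H` for which the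
quotient map `G → G ⧸ H` is a smooth `H`-principal bundle. Both structures are unique. -/
structure SplitLieSubgroup {G : Type u₂} [Group G] (A : LCManifold.{u₁, u₂, v} 𝕜 G)
    (H : Subgroup G) where
  sub : LCManifold.{u₁, u₂, v} 𝕜 H
  sub_lie : sub.IsLieGroup
  quot : LCManifold.{u₁, u₂, v} 𝕜 (G ⧸ H)
  bundle : IsPrincipalBundle sub A quot H.subtype (fun g => (g : G ⧸ H))

/-- `1 → N → P → G → 1`, with maps `i` and `q`, is an extension of Lie groups. Exactness at `N` and
`P` is contained in the fields `free` and `fiber` of `bundle`, and surjectivity of `q` in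
`locally_trivial`. -/
structure IsLieExtension {N : Type u₂} [Group N] {P : Type u₃} [Group P] {G : Type u₄} [Group G]
    (A : LCManifold.{u₁, u₂, v} 𝕜 N) (B : LCManifold.{u₁, u₃, v} 𝕜 P)
    (C : LCManifold.{u₁, u₄, v} 𝕜 G) (i : N →* P) (q : P →* G) : Prop where
  lie_kernel : A.IsLieGroup
  lie_total : B.IsLieGroup
  lie_base : C.IsLieGroup
  bundle : IsPrincipalBundle A B C i q

/-- Two extensions `N → P → G` and `N → P' → G` are equivalent: there is a morphism of Lie groups
`P → P'` compatible with the identities of `N` and `G`. -/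
def ExtensionEquivalent {N : Type u₂} [Group N] {P P' : Type u₃} [Group P] [Group P']
    {G : Type u₄} [Group G]
    (B : LCManifold.{u₁, u₃, v} 𝕜 P) (B' : LCManifold.{u₁, u₃, v} 𝕜 P')
    (i : N →* P) (q : P →* G) (i' : N →* P') (q' : P' →* G) : Prop :=
  ∃ φ : P →* P', B.Smooth B' φ ∧ (∀ n, φ (i n) = i' n) ∧ ∀ p, q' (φ p) = q p

/-! ## Automorphisms, actions, crossed modules -/

/-- `φ` is an automorphism of the Lie group `N`. -/
def IsLieAut {N : Type u₂} [Group N] (B : LCManifold.{u₁, u₂, v} 𝕜 N) (φ : MulAut N) : Prop :=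
  B.Diffeo B φ.toEquiv

/-- The homomorphism `r` is a smooth action of `G` on `N` by Lie group automorphisms. -/
def IsSmoothAction {G : Type u₂} [Group G] {N : Type u₃} [Group N]
    (A : LCManifold.{u₁, u₂, v} 𝕜 G) (B : LCManifold.{u₁, u₃, v} 𝕜 N) (r : G →* MulAut N) : Prop :=
  (∀ g, IsLieAut B (r g)) ∧ (A.prod B).Smooth B (fun p => r p.1 p.2)

/-- A smooth crossed module `α : H → G` with the action `r` of `G` on `H`. -/
structure IsSmoothCrossedModule {H : Type u₂} [Group H] {G : Type u₃} [Group G]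
    (A : LCManifold.{u₁, u₂, v} 𝕜 H) (B : LCManifold.{u₁, u₃, v} 𝕜 G)
    (α : H →* G) (r : G →* MulAut H) : Prop where
  lie_source : A.IsLieGroup
  lie_target : B.IsLieGroup
  smooth : A.Smooth B α
  action : IsSmoothAction B A r
  equivariant : ∀ (g : G) (h : H), α (r g h) = g * α h * g⁻¹
  peiffer : ∀ h : H, r (α h) = MulAut.conj h
  split : ∃ (K : SplitLieSubgroup A α.ker) (I : SplitLieSubgroup B α.range),
    K.quot.Diffeo I.sub (QuotientGroup.quotientKerEquivRange α).toEquiv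

/-! ## Locally smooth cochains -/

/-- `δ_f (g, g') = f(g) f(g') f(g g')⁻¹`. -/
def delta {G : Type u₂} [Group G] {K : Type u₃} [Group K] (f : G → K) (g g' : G) : K :=
  f g * f g' * (f (g * g'))⁻¹

/-- The set `C^1_s(G, N)` of normalized locally smooth `1`-cochains. -/
def IsCochain₁ {G : Type u₂} [Group G] {N : Type u₃} [Group N]
    (A : LCManifold.{u₁, u₂, v} 𝕜 G) (B : LCManifold.{u₁, u₃, v} 𝕜 N) (f : G → N) : Prop :=
  f 1 = 1 ∧ ∃ U : Set G, A.IsOpenSet U ∧ 1 ∈ U ∧ A.SmoothOn B f U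

/-- The set `C^2_s(G, N)` of normalized locally smooth `2`-cochains. -/
def IsCochain₂ {G : Type u₂} [Group G] {N : Type u₃} [Group N]
    (A : LCManifold.{u₁, u₂, v} 𝕜 G) (B : LCManifold.{u₁, u₃, v} 𝕜 N) (ω : G × G → N) : Prop :=
  (∀ g, ω (1, g) = 1) ∧ (∀ g, ω (g, 1) = 1) ∧
    ∃ U : Set (G × G), (A.prod A).IsOpenSet U ∧ 1 ∈ U ∧ (A.prod A).SmoothOn B ω U

/-- The subset `C^2_ss(G, N)` of `C^2_s(G, N)`: for each `g`, the map
`x ↦ ω(g, x) ω(g x g⁻¹, g)⁻¹` is smooth in an identity neighbourhood. -/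
def IsCochain₂ss {G : Type u₂} [Group G] {N : Type u₃} [Group N]
    (A : LCManifold.{u₁, u₂, v} 𝕜 G) (B : LCManifold.{u₁, u₃, v} 𝕜 N) (ω : G × G → N) : Prop :=
  IsCochain₂ A B ω ∧ ∀ g : G, ∃ U : Set G, A.IsOpenSet U ∧ 1 ∈ U ∧
    A.SmoothOn B (fun x => ω (g, x) * (ω (g * x * g⁻¹, g))⁻¹) U

/-! ## Smooth outer actions -/

/-- A smooth outer action of `G` on `N`. -/
structure SmoothOuterAction {G : Type u₂} [Group G] {N : Type u₃} [Group N]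
    (A : LCManifold.{u₁, u₂, v} 𝕜 G) (B : LCManifold.{u₁, u₃, v} 𝕜 N) where
  toFun : G → MulAut N
  lieAut : ∀ g, IsLieAut B (toFun g)
  normalized : toFun 1 = 1
  locally_smooth : ∃ U : Set G, A.IsOpenSet U ∧ 1 ∈ U ∧
    (A.prod B).SmoothOn B (fun p => toFun p.1 p.2) (U ×ˢ univ)
  outer : ∃ ω : G × G → N, IsCochain₂ A B ω ∧
    ∀ g g', delta toFun g g' = MulAut.conj (ω (g, g'))

/-- The homomorphism `N ⧸ Z(N) → Aut(N)` induced by conjugation. -/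
def conjAd {N : Type u₃} [Group N] : N ⧸ Subgroup.center N →* MulAut N :=
  QuotientGroup.lift (Subgroup.center N) MulAut.conj (fun z hz => by
    ext n
    have := Subgroup.mem_center_iff.1 hz n
    simp [← this])

theorem conjAd_injective {N : Type u₃} [Group N] : Function.Injective (conjAd (N := N)) := by
  rw [injective_iff_map_eq_one]
  intro a
  induction a using QuotientGroup.induction_on with
  | H n =>
    intro h
    refine (QuotientGroup.eq_one_iff n).2 (Subgroup.mem_center_iff.2 fun m => ?_)
    have h' : n * m * n⁻¹ = m := DFunLike.congr_fun h m
    exact (mul_inv_eq_iff_eq_mul.1 h').symm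

namespace SmoothOuterAction

variable {G : Type u₂} [Group G] {N : Type u₃} [Group N]
  {A : LCManifold.{u₁, u₂, v} 𝕜 G} {B : LCManifold.{u₁, u₃, v} 𝕜 N}

/-- `S` is strongly smooth: `ω` with `δ_S = C_N ∘ ω` can be chosen in `C^2_ss(G, N)`. -/
def IsStronglySmooth (S : SmoothOuterAction A B) : Prop :=
  ∃ ω : G × G → N, IsCochain₂ss A B ω ∧
    ∀ g g', delta S.toFun g g' = MulAut.conj (ω (g, g'))

/-- `S ∼ S'`, i.e. `S' = (C_N ∘ h) · S` for some `h` in `C^1_s(G, N)`. -/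
def Equivalent (S S' : SmoothOuterAction A B) : Prop :=
  ∃ h : G → N, IsCochain₁ A B h ∧ ∀ g, S'.toFun g = MulAut.conj (h g) * S.toFun g

/-- The automorphism `n Z(N) ↦ S(g)(n) Z(N)` of `N ⧸ Z(N)`. -/
def actAd (S : SmoothOuterAction A B) (g : G) :
    N ⧸ Subgroup.center N →* N ⧸ Subgroup.center N :=
  QuotientGroup.map (Subgroup.center N) (Subgroup.center N) (S.toFun g).toMonoidHom
    (fun z hz => Subgroup.mem_center_iff.2 fun n => by
      have := Subgroup.mem_center_iff.1 hz ((S.toFun g).symm n)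
      simpa using congrArg (S.toFun g) this)

/-- `δ_S` as a function with values in `N ⧸ Z(N)`; see `conjAd_deltaAd`. -/
noncomputable def deltaAd (S : SmoothOuterAction A B) (g g' : G) : N ⧸ Subgroup.center N :=
  ((S.outer.choose (g, g') : N) : N ⧸ Subgroup.center N)

theorem conjAd_deltaAd (S : SmoothOuterAction A B) (g g' : G) :
    conjAd (S.deltaAd g g') = delta S.toFun g g' :=
  (S.outer.choose_spec.2 g g').symm

theorem conjAd_actAd (S : SmoothOuterAction A B) (g : G) (a : N ⧸ Subgroup.center N) :
    conjAd (S.actAd g a) = S.toFun g * conjAd a * (S.toFun g)⁻¹ := by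
  induction a using QuotientGroup.induction_on with
  | H n =>
    ext m
    change S.toFun g n * m * (S.toFun g n)⁻¹ = S.toFun g (n * (S.toFun g)⁻¹ m * n⁻¹)
    simp

theorem deltaAd_one_one (S : SmoothOuterAction A B) : S.deltaAd 1 1 = 1 :=
  conjAd_injective (by rw [conjAd_deltaAd, map_one conjAd]; simp [delta, S.normalized])

/-- The underlying set `N_ad × G` of `G^S`, where `N_ad = N ⧸ Z(N)`. -/
@[ext]
structure GS (S : SmoothOuterAction A B) where
  ad : N ⧸ Subgroup.center N
  base : G

namespace GS

variable {S : SmoothOuterAction A B}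

/-- `(a, g) (a', g') = (a · S(g)(a') · δ_S(g, g'), g g')`. -/
noncomputable instance : Mul S.GS :=
  ⟨fun x y => ⟨x.ad * S.actAd x.base y.ad * S.deltaAd x.base y.base, x.base * y.base⟩⟩

instance : One S.GS := ⟨⟨1, 1⟩⟩

noncomputable instance : Inv S.GS :=
  ⟨fun x => ⟨(S.deltaAd x.base⁻¹ x.base)⁻¹ * (S.actAd x.base⁻¹ x.ad)⁻¹, x.base⁻¹⟩⟩

theorem mul_def (x y : S.GS) :
    x * y = ⟨x.ad * S.actAd x.base y.ad * S.deltaAd x.base y.base, x.base * y.base⟩ := rfl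

theorem one_def : (1 : S.GS) = ⟨1, 1⟩ := rfl

theorem inv_def (x : S.GS) :
    x⁻¹ = ⟨(S.deltaAd x.base⁻¹ x.base)⁻¹ * (S.actAd x.base⁻¹ x.ad)⁻¹, x.base⁻¹⟩ := rfl

theorem conjAd_mul (x y : S.GS) :
    conjAd (x * y).ad * S.toFun (x * y).base =
      (conjAd x.ad * S.toFun x.base) * (conjAd y.ad * S.toFun y.base) := by
  simp only [mul_def, map_mul, conjAd_actAd, conjAd_deltaAd, delta]
  group

theorem ext_conjAd {x y : S.GS} (hb : x.base = y.base)
    (h : conjAd x.ad * S.toFun x.base = conjAd y.ad * S.toFun y.base) : x = y := by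
  refine GS.ext (conjAd_injective ?_) hb
  rw [hb] at h
  exact mul_right_cancel h

noncomputable instance : Group S.GS :=
  Group.ofLeftAxioms
    (fun x y z => ext_conjAd (mul_assoc _ _ _) (by simp only [conjAd_mul, mul_assoc]))
    (fun x => ext_conjAd (one_mul _) (by
      rw [conjAd_mul]; simp [one_def, S.normalized]))
    (fun x => GS.ext
      (by
        simp only [mul_def, inv_def, one_def]
        group)
      (inv_mul_cancel x.base))

/-- The projection `q_S : G^S → G`. -/
noncomputable def proj (S : SmoothOuterAction A B) : S.GS →* G where
  toFun x := x.base
  map_one' := rfl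
  map_mul' _ _ := rfl

/-- The inclusion `N_ad → G^S`, `a ↦ (a, 1)`. -/
noncomputable def incl (S : SmoothOuterAction A B) : N ⧸ Subgroup.center N →* S.GS where
  toFun a := ⟨a, 1⟩
  map_one' := rfl
  map_mul' a b := ext_conjAd (one_mul _).symm (by
    rw [conjAd_mul]; simp [S.normalized])

/-- `L` is a Lie group structure on `G^S` for which the identical map `N_ad × G → G^S` restricts
to a diffeomorphism of `N_ad × U` onto the open subset `q_S ⁻¹ U`, for some open identity
neighbourhood `U` of `G`. Here `Q` is the manifold structure of `N_ad`. -/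
structure IsNatural (S : SmoothOuterAction A B)
    (Q : LCManifold.{u₁, u₃, v} 𝕜 (N ⧸ Subgroup.center N))
    (L : LCManifold.{u₁, max u₂ u₃, v} 𝕜 S.GS) : Prop where
  lie : L.IsLieGroup
  local_product : ∃ U : Set G, A.IsOpenSet U ∧ 1 ∈ U ∧ L.IsOpenSet (proj S ⁻¹' U) ∧
    (Q.prod A).SmoothOn L (fun p => (⟨p.1, p.2⟩ : S.GS)) (univ ×ˢ U) ∧
    L.SmoothOn (Q.prod A) (fun x => (x.ad, x.base)) (proj S ⁻¹' U)

end GS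

end SmoothOuterAction

end LieGroups

/-! ## Calculus on locally convex spaces: the chain rule -/

section Calculus

variable {𝕜 : Type u₁} [RCLike 𝕜]
  {E : Type u₂} [AddCommGroup E] [Module 𝕜 E] [TopologicalSpace E]
  {E' : Type u₃} [AddCommGroup E'] [Module 𝕜 E'] [TopologicalSpace E']
  {F : Type u₄} [AddCommGroup F] [Module 𝕜 F] [TopologicalSpace F]

/-! The map $(a,g)\mapsto(C_N(a)S(g),g)$ embeds $G^S$ into $\mathrm{Aut}(N)\times G$, because
$N_{\rm ad}$ acts faithfully on $N$. Every algebraic identity in $G^S$ is therefore checked in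
$\mathrm{Aut}(N)$ and in $G$ (`ext_toAut`).

The Lie group structure comes from local data. The full product manifold $N_{\rm ad}\times G$ is in
general not a Lie group, but its multiplication and inversion are smooth near the identity, since
$S$ and $\omega$ are smooth there. By `exists_isLieGroup` it then suffices that every conjugation is
smooth at the identity. For elements of $N_{\rm ad}$ this follows from the local smoothness of $S$.
For $(1,g)$ the formula `one_mk_conj` contains exactly the map
$x\mapsto\omega(g,x)\omega(gxg^{-1},g)^{-1}$ modulo the center, so strong smoothness is the
condition needed.

Everything else is reduced to the identity by translation: a homomorphism smooth near $1$ is smooth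
(`IsLieGroup.smooth_hom`). This gives uniqueness, the equivalence of extensions for $S\sim S'$
through $(a,g)\mapsto(a\,C_N(h(g)),g)$, and the smoothness of the action. The bundle structure comes
from the section $g\mapsto(1,g)$ and the retraction $(a,g)\mapsto a$
(`isPrincipalBundle_of_section`). Kernel, image and cokernel of the crossed module are identified
using that the base of a principal bundle is determined by its total space and fibres
(`diffeo_base`).

The calculus needed underneath is the chain rule, derived from a mean value estimate for seminorms,
together with the gluing of manifolds along smooth transition maps. -/

theorem CnOn.of_succ {n : ℕ} {f : E → F} {U : Set E} (h : CnOn 𝕜 (n + 1) f U) :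
    CnOn 𝕜 n f U := by
  induction n generalizing E F with
  | zero => exact h.1
  | succ n ih =>
    obtain ⟨hc, df, hd, hs⟩ := h
    exact ⟨hc, df, hd, ih hs⟩

theorem cnOn_const (n : ℕ) (c : F) (U : Set E) : CnOn 𝕜 n (fun _ : E => c) U := by
  induction n generalizing E F with
  | zero => exact continuousOn_const
  | succ n ih =>
    refine ⟨continuousOn_const, fun _ => 0, fun x _ h => ?_, ih 0 _⟩
    simp only [sub_self, smul_zero]
    exact tendsto_const_nhds

theorem tendsto_add_smul_nhdsNE [IsTopologicalAddGroup E] [ContinuousSMul 𝕜 E] (x h : E) :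
    Tendsto (fun t : 𝕜 => x + t • h) (𝓝[≠] 0) (𝓝 x) := by
  have : Tendsto (fun t : 𝕜 => x + t • h) (𝓝 0) (𝓝 (x + (0 : 𝕜) • h)) :=
    (continuous_const.add (continuous_id.smul continuous_const)).tendsto 0
  rw [zero_smul, add_zero] at this
  exact this.mono_left nhdsWithin_le_nhds

/-- The same derivative serves for both maps: `U` is open, so `x + t • k` stays in `U` for small `t`
and the difference quotients agree. -/
theorem CnOn.congr [IsTopologicalAddGroup E] [ContinuousSMul 𝕜 E] {n : ℕ} {f g : E → F}
    {U : Set E} (hU : IsOpen U) (hf : CnOn 𝕜 n f U) (h : EqOn g f U) : CnOn 𝕜 n g U := by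
  cases n with
  | zero => exact ContinuousOn.congr hf h
  | succ n =>
    obtain ⟨hc, df, hd, hs⟩ := hf
    refine ⟨hc.congr h, df, fun x hx k => (hd x hx k).congr' ?_, hs⟩
    filter_upwards [(tendsto_add_smul_nhdsNE (𝕜 := 𝕜) x k).eventually (hU.mem_nhds hx)] with t ht
    rw [h hx, h ht]

/-- Being of class `C^n` is a local property. -/
theorem CnOn.of_local [IsTopologicalAddGroup E] [ContinuousSMul 𝕜 E] [T2Space F] {n : ℕ}
    {f : E → F} {U : Set E}
    (h : ∀ x ∈ U, ∃ W : Set E, IsOpen W ∧ x ∈ W ∧ CnOn 𝕜 n f W) : CnOn 𝕜 n f U := by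
  have hc : ContinuousOn f U := fun x hx => by
    obtain ⟨W, hW, hxW, hf⟩ := h x hx
    exact (hf.continuousOn.continuousAt (hW.mem_nhds hxW)).continuousWithinAt
  induction n generalizing E F with
  | zero => exact hc
  | succ n ih =>
    classical
    -- The hypothesis gives a separate derivative on each `W`. Choosing the limit wherever it exists
    -- produces one global candidate, and uniqueness of limits in `F` identifies it with each local
    -- derivative; the value `0` elsewhere is irrelevant.
    set df : E × E → F := fun p =>
      if hp : ∃ v : F, Tendsto (fun t : 𝕜 => t⁻¹ • (f (p.1 + t • p.2) - f p.1)) (𝓝[≠] 0) (𝓝 v)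
      then hp.choose else 0
    have key : ∀ (x k : E) (v : F),
        Tendsto (fun t : 𝕜 => t⁻¹ • (f (x + t • k) - f x)) (𝓝[≠] 0) (𝓝 v) → df (x, k) = v := by
      intro x k v hv
      have hp : ∃ v : F, Tendsto (fun t : 𝕜 => t⁻¹ • (f (x + t • k) - f x)) (𝓝[≠] 0) (𝓝 v) :=
        ⟨v, hv⟩
      have : df (x, k) = hp.choose := dif_pos hp
      rw [this]
      exact tendsto_nhds_unique hp.choose_spec hv
    have hs' : ∀ p ∈ U ×ˢ (univ : Set E), ∃ W : Set (E × E), IsOpen W ∧ p ∈ W ∧ CnOn 𝕜 n df W := by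
      rintro ⟨x, k⟩ ⟨hx, -⟩
      obtain ⟨W, hW, hxW, -, df', hd', hs'⟩ := h x hx
      refine ⟨W ×ˢ univ, hW.prod isOpen_univ, ⟨hxW, mem_univ _⟩,
        hs'.congr (hW.prod isOpen_univ) ?_⟩
      rintro ⟨y, l⟩ ⟨hy, -⟩
      exact key _ _ _ (hd' y hy l)
    refine ⟨hc, df, fun x hx k => ?_, ih hs' fun p hp => ?_⟩
    · obtain ⟨W, hW, hxW, -, df', hd', -⟩ := h x hx
      rw [key _ _ _ (hd' x hxW k)]
      exact hd' x hxW k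
    · obtain ⟨W, hW, hpW, hf⟩ := hs' p hp
      exact (hf.continuousOn.continuousAt (hW.mem_nhds hpW)).continuousWithinAt

/-- The mean value inequality for a seminorm. -/
theorem Seminorm.sub_sub_le_of_tendsto {p : Seminorm 𝕜 F} (hp : Continuous p)
    [IsTopologicalAddGroup F] [ContinuousSMul 𝕜 F]
    {φ φ' : ℝ → F} (hφ : ContinuousOn φ (Icc 0 1))
    (hd : ∀ s ∈ Icc (0 : ℝ) 1,
      Tendsto (fun r : ℝ => (r : 𝕜)⁻¹ • (φ (s + r) - φ s)) (𝓝[>] 0) (𝓝 (φ' s)))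
    {w : F} {C : ℝ} (hC : ∀ s ∈ Icc (0 : ℝ) 1, p (φ' s - w) ≤ C) :
    p (φ 1 - φ 0 - w) ≤ C := by
  have hcont : ContinuousOn (fun s : ℝ => p (φ s - φ 0 - (s : 𝕜) • w)) (Icc 0 1) := by
    refine hp.comp_continuousOn ((hφ.sub continuousOn_const).sub ?_)
    exact (RCLike.continuous_ofReal.smul continuous_const).continuousOn
  -- The seminorm of `φ s - φ 0 - s • w` is a real function of `s`. Its right-hand slopes are
  -- asymptotically at most `C`, so it stays below `C * s`.
  have := image_le_of_liminf_slope_right_le_deriv_boundary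
    (f := fun s : ℝ => p (φ s - φ 0 - (s : 𝕜) • w)) (a := 0) (b := 1) hcont
    (B := fun s => C * s) (B' := fun _ => C) (by simp) (by fun_prop)
    (fun x _ => by simpa using ((hasDerivAt_id x).const_mul C).hasDerivWithinAt) ?_
    (right_mem_Icc.2 zero_le_one)
  · simpa using this
  intro s hs r hr
  have hs' : s ∈ Icc (0 : ℝ) 1 := ⟨hs.1, hs.2.le⟩
  have h1 : Tendsto (fun z : ℝ => z - s) (𝓝[>] s) (𝓝[>] 0) := by
    refine tendsto_nhdsWithin_iff.2 ⟨?_, ?_⟩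
    · have : Tendsto (fun z : ℝ => z - s) (𝓝 s) (𝓝 (s - s)) :=
        (continuous_id.sub continuous_const).tendsto s
      rw [sub_self] at this
      exact this.mono_left nhdsWithin_le_nhds
    · filter_upwards [self_mem_nhdsWithin] with z hz
      exact mem_Ioi.2 (sub_pos.2 hz)
  have h2 := (hp.tendsto _).comp ((((hd s hs').comp h1)).sub_const w)
  refine Eventually.frequently ?_
  filter_upwards [h2.eventually_lt_const ((hC s hs').trans_lt hr), self_mem_nhdsWithin] with z hz hz'
  refine lt_of_le_of_lt ?_ hz
  have hpos : 0 < z - s := sub_pos.2 hz'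
  have hne : ((z - s : ℝ) : 𝕜) ≠ 0 := RCLike.ofReal_ne_zero.2 hpos.ne'
  rw [slope_def_field, div_le_iff₀ hpos]
  simp only [Function.comp_apply]
  -- Homogeneity of `p` clears the denominator; the slope bound is then the triangle inequality.
  have h3 : p (((z - s : ℝ) : 𝕜) • ((((z - s : ℝ) : 𝕜))⁻¹ • (φ (s + (z - s)) - φ s) - w)) =
      (z - s) * p ((((z - s : ℝ) : 𝕜))⁻¹ • (φ (s + (z - s)) - φ s) - w) := by
    rw [map_smul_eq_mul, RCLike.norm_ofReal, abs_of_pos hpos]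
  rw [mul_comm, ← h3, smul_sub, smul_smul, mul_inv_cancel₀ hne, one_smul, add_sub_cancel,
    sub_le_iff_le_add]
  refine le_trans (le_of_eq ?_) (map_add_le_add p _ _)
  congr 1
  push_cast
  rw [sub_smul]
  abel

/-- The difference quotients of a `C^1` map converge locally uniformly. -/
theorem tendsto_differenceQuotient [IsTopologicalAddGroup E] [ContinuousSMul 𝕜 E]
    [PolynormableSpace 𝕜 F] {f : E → F} {U : Set E} (hU : IsOpen U)
    (hf : ContinuousOn f U) {df : E × E → F}
    (hd : ∀ x ∈ U, ∀ h : E,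
      Tendsto (fun t : 𝕜 => t⁻¹ • (f (x + t • h) - f x)) (𝓝[≠] 0) (𝓝 (df (x, h))))
    (hdf : ContinuousOn df (U ×ˢ univ)) {x : E} (hx : x ∈ U) (h : E) :
    Tendsto (fun q : 𝕜 × E × E => q.1⁻¹ • (f (q.2.1 + q.1 • q.2.2) - f q.2.1))
      (𝓝[≠] 0 ×ˢ 𝓝 (x, h)) (𝓝 (df (x, h))) := by
  have hws := PolynormableSpace.withSeminorms 𝕜 F
  have := hws.topologicalAddGroup
  have := hws.continuousSMul
  rw [hws.tendsto_nhds]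
  intro p ε hε
  have hpc : Continuous p.1 := hws.continuous_seminorm p
  set p := p.1
  have hWopen : IsOpen (U ×ˢ (univ : Set E)) := hU.prod isOpen_univ
  have hnear : ∀ᶠ y : E × E in 𝓝 (x, h), y.1 ∈ U ∧ p (df y - df (x, h)) < ε / 2 := by
    have hxU : ∀ᶠ y : E × E in 𝓝 (x, h), y ∈ U ×ˢ (univ : Set E) :=
      hWopen.mem_nhds ⟨hx, mem_univ _⟩
    refine (hxU.mono fun y hy => hy.1).and ?_
    have hcont : ContinuousAt (fun y => p (df y - df (x, h))) (x, h) :=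
      hpc.continuousAt.comp
        ((hdf.continuousAt (hWopen.mem_nhds ⟨hx, mem_univ _⟩)).sub continuousAt_const)
    have h0 : p (df (x, h) - df (x, h)) < ε / 2 := by
      rw [sub_self, map_zero]; positivity
    exact hcont.eventually_lt continuousAt_const h0
  -- At `t = 0` the whole segment collapses to `x`. Compactness of `[0,1]` gives one neighbourhood
  -- of `(0, x, h)` that works for all `s`.
  have htube : ∀ᶠ q : 𝕜 × E × E in 𝓝 (0, x, h), ∀ s ∈ Icc (0 : ℝ) 1,
      q.2.1 + ((s : 𝕜) * q.1) • q.2.2 ∈ U ∧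
        p (df (q.2.1 + ((s : 𝕜) * q.1) • q.2.2, q.2.2) - df (x, h)) < ε / 2 := by
    refine isCompact_Icc.eventually_forall_of_forall_eventually fun s _ => ?_
    have hcont : Continuous fun z : (𝕜 × E × E) × ℝ =>
        (z.1.2.1 + ((z.2 : 𝕜) * z.1.1) • z.1.2.2, z.1.2.2) := by
      have : Continuous fun z : (𝕜 × E × E) × ℝ => (z.2 : 𝕜) :=
        RCLike.continuous_ofReal.comp continuous_snd
      fun_prop
    have ht := hcont.tendsto ((0, x, h), s)
    simp only [mul_zero, zero_smul, add_zero] at ht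
    exact ht.eventually hnear
  have hle : (𝓝[≠] (0 : 𝕜)) ×ˢ 𝓝 (x, h) ≤ 𝓝 (0, x, h) := by
    rw [nhds_prod_eq (x := (0 : 𝕜))]
    exact prod_mono nhdsWithin_le_nhds le_rfl
  have hne : ∀ᶠ q : 𝕜 × E × E in (𝓝[≠] (0 : 𝕜)) ×ˢ 𝓝 (x, h), q.1 ≠ 0 :=
    tendsto_fst.eventually self_mem_nhdsWithin
  filter_upwards [hle htube, hne] with q hq hq0
  obtain ⟨t, y, k⟩ := q
  simp only at hq hq0 ⊢
  -- Dividing by `t` makes `φ 1 - φ 0` the difference quotient and `df (y + (s * t) • k, k)` the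
  -- derivative of `φ` at `s`.
  set φ : ℝ → F := fun s => t⁻¹ • f (y + ((s : 𝕜) * t) • k)
  have hmv := p.sub_sub_le_of_tendsto hpc (φ := φ)
    (φ' := fun s => df (y + ((s : 𝕜) * t) • k, k)) (w := df (x, h)) (C := ε / 2) ?_ ?_
    fun s hs => (hq s hs).2.le
  · have : φ 1 - φ 0 = t⁻¹ • (f (y + t • k) - f y) := by
      simp [φ, smul_sub]
    rw [this] at hmv
    exact hmv.trans_lt (half_lt_self hε)
  · refine ContinuousOn.const_smul ?_ t⁻¹
    refine hf.comp ?_ fun s hs => (hq s hs).1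
    have : Continuous fun s : ℝ => (s : 𝕜) := RCLike.continuous_ofReal
    fun_prop
  · intro s hs
    have h1 : Tendsto (fun r : ℝ => (r : 𝕜) * t) (𝓝[>] 0) (𝓝[≠] 0) := by
      refine tendsto_nhdsWithin_iff.2 ⟨?_, ?_⟩
      · have hc : Continuous fun r : ℝ => (r : 𝕜) * t :=
          RCLike.continuous_ofReal.mul continuous_const
        have := hc.tendsto 0
        simp only [RCLike.ofReal_zero, zero_mul] at this
        exact this.mono_left nhdsWithin_le_nhds
      · filter_upwards [self_mem_nhdsWithin] with r hr
        exact mul_ne_zero (RCLike.ofReal_ne_zero.2 (ne_of_gt hr)) hq0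
    refine ((hd _ (hq s hs).1 k).comp h1).congr fun r => ?_
    simp only [Function.comp_apply, φ, ← smul_sub, smul_smul, mul_inv]
    congr 3
    push_cast
    rw [add_mul, add_smul, add_assoc]

/-- The chain rule. -/
theorem CnOn.comp [IsTopologicalAddGroup E'] [ContinuousSMul 𝕜 E']
    [PolynormableSpace 𝕜 F] {n : ℕ} {f : E' → F} {g : E → E'} {U : Set E} {V : Set E'}
    (hf : CnOn 𝕜 n f V) (hg : CnOn 𝕜 n g U) (hV : IsOpen V) (h : MapsTo g U V) :
    CnOn 𝕜 n (fun x => f (g x)) U := by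
  induction n generalizing E E' F with
  | zero => exact ContinuousOn.comp hf hg h
  | succ n ih =>
    have hg' := hg.of_succ
    obtain ⟨hfc, df, hdf, hfs⟩ := hf
    obtain ⟨hgc, dg, hdg, hgs⟩ := hg
    refine ⟨hfc.comp hgc h, fun p => df (g p.1, dg p), fun x hx k => ?_, ?_⟩
    · have hq := tendsto_differenceQuotient hV hfc hdf hfs.continuousOn (h hx) (dg (x, k))
      -- The increment of `g` is `t` times its difference quotient, so the composite is
      -- differentiated along a direction varying with `t`. This is why the difference quotients of
      -- `f` must converge jointly in the direction.
      have hin : Tendsto (fun t : 𝕜 => (t, g x, t⁻¹ • (g (x + t • k) - g x))) (𝓝[≠] 0)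
          (𝓝[≠] 0 ×ˢ 𝓝 (g x, dg (x, k))) :=
        tendsto_id.prodMk (tendsto_const_nhds.prodMk_nhds (hdg x hx k))
      refine (hq.comp hin).congr' ?_
      filter_upwards [self_mem_nhdsWithin] with t ht
      simp only [Function.comp_apply]
      rw [smul_smul, mul_inv_cancel₀ ht, one_smul, add_sub_cancel]
    · refine ih (f := df) (g := fun p : E × E => (g p.1, dg p)) hfs ?_ (hV.prod isOpen_univ)
        fun p hp => ⟨h hp.1, mem_univ _⟩
      refine CnOn.prodMk ((hg'.comp_linear (ContinuousLinearMap.fst 𝕜 E E)).mono ?_) hgs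
      exact fun p hp => hp.1

end Calculus

/-! ## Smooth maps between manifolds modelled on locally convex spaces -/

namespace LCManifold

variable {𝕜 : Type u₁} [RCLike 𝕜]

/-- The neighbourhood filter in the topology of the manifold. -/
def nhds {M : Type u₂} (A : LCManifold.{u₁, u₂, v} 𝕜 M) (x : M) : Filter M :=
  letI := A.top
  𝓝 x

/-- `f` is smooth on an open neighbourhood of `x`. -/
def SmoothAt {M : Type u₂} {M' : Type u₃} (A : LCManifold.{u₁, u₂, v} 𝕜 M)
    (B : LCManifold.{u₁, u₃, v} 𝕜 M') (f : M → M') (x : M) : Prop :=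
  ∃ U : Set M, A.IsOpenSet U ∧ x ∈ U ∧ A.SmoothOn B f U

universe w₁ w₂ w₃
variable {M₁ : Type w₁} {M₂ : Type w₂} {M₃ : Type w₃}
  {A : LCManifold.{u₁, w₁, v} 𝕜 M₁} {B : LCManifold.{u₁, w₂, v} 𝕜 M₂}
  {C : LCManifold.{u₁, w₃, v} 𝕜 M₃}

/-! ### Open sets and neighbourhoods. -/

theorem IsOpenSet.mem_nhds {U : Set M₁} (hU : A.IsOpenSet U) {x : M₁} (hx : x ∈ U) :
    U ∈ A.nhds x :=
  letI := A.top
  IsOpen.mem_nhds hU hx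

theorem mem_nhds_iff {s : Set M₁} {x : M₁} :
    s ∈ A.nhds x ↔ ∃ U ⊆ s, A.IsOpenSet U ∧ x ∈ U :=
  letI := A.top
  _root_.mem_nhds_iff

theorem isOpenSet_iff {U : Set M₁} : A.IsOpenSet U ↔ ∀ x ∈ U, U ∈ A.nhds x :=
  letI := A.top
  isOpen_iff_mem_nhds

theorem isOpenSet_univ : A.IsOpenSet univ :=
  letI := A.top
  isOpen_univ

theorem IsOpenSet.inter {U V : Set M₁} (hU : A.IsOpenSet U) (hV : A.IsOpenSet V) :
    A.IsOpenSet (U ∩ V) :=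
  letI := A.top
  IsOpen.inter hU hV

theorem IsOpenSet.prod {U : Set M₁} {V : Set M₂} (hU : A.IsOpenSet U) (hV : B.IsOpenSet V) :
    (A.prod B).IsOpenSet (U ×ˢ V) :=
  letI := A.top
  letI := B.top
  IsOpen.prod hU hV

theorem nhds_prod (x : M₁ × M₂) : (A.prod B).nhds x = A.nhds x.1 ×ˢ B.nhds x.2 :=
  letI := A.top
  letI := B.top
  nhds_prod_eq

theorem mem_of_mem_nhds {s : Set M₁} {x : M₁} (h : s ∈ A.nhds x) : x ∈ s :=
  letI := A.top
  _root_.mem_of_mem_nhds h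

theorem eventually_self {p : M₁ → Prop} {x : M₁} (h : ∀ᶠ y in A.nhds x, p y) : p x :=
  mem_of_mem_nhds h

theorem isOpenSet_setOf_eventually (A : LCManifold.{u₁, w₁, v} 𝕜 M₁) (p : M₁ → Prop) :
    A.IsOpenSet {x | ∀ᶠ y in A.nhds x, p y} :=
  letI := A.top
  isOpen_setOfPred_eventually_nhds

/-! ### Smooth maps: locality, composition, products. -/

theorem SmoothOn.mono {f : M₁ → M₂} {U V : Set M₁} (h : A.SmoothOn B f U) (hVU : V ⊆ U) :
    A.SmoothOn B f V := by
  let := A.top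
  let := B.top
  let := A.charted
  let := B.charted
  exact ⟨h.1.mono hVU, fun e he e' he' n =>
    (h.2 e he e' he' n).mono fun x hx => ⟨hx.1, hVU hx.2.1, hx.2.2⟩⟩

theorem SmoothOn.smoothAt {f : M₁ → M₂} {U : Set M₁} (h : A.SmoothOn B f U)
    (hU : A.IsOpenSet U) {x : M₁} (hx : x ∈ U) : A.SmoothAt B f x :=
  ⟨U, hU, hx, h⟩

theorem Smooth.smoothAt {f : M₁ → M₂} (h : A.Smooth B f) (x : M₁) : A.SmoothAt B f x :=
  SmoothOn.smoothAt h isOpenSet_univ (mem_univ x)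

theorem SmoothAt.eventually {f : M₁ → M₂} {x : M₁} (h : A.SmoothAt B f x) :
    ∀ᶠ y in A.nhds x, A.SmoothAt B f y := by
  obtain ⟨U, hU, hx, hf⟩ := h
  filter_upwards [hU.mem_nhds hx] with y hy
  exact ⟨U, hU, hy, hf⟩

theorem SmoothAt.tendsto {f : M₁ → M₂} {x : M₁} (h : A.SmoothAt B f x) :
    Tendsto f (A.nhds x) (B.nhds (f x)) := by
  let := A.top
  let := B.top
  obtain ⟨U, hU, hx, hf⟩ := h
  exact hf.1.continuousAt (IsOpen.mem_nhds hU hx)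

/-- Rests on `CnOn.of_local`. It allows global smoothness to be proved point by point, where
translations are available. -/
theorem smoothOn_of_smoothAt {f : M₁ → M₂} {U : Set M₁} (h : ∀ x ∈ U, A.SmoothAt B f x) :
    A.SmoothOn B f U := by
  let := A.top
  let := B.top
  let := A.charted
  let := B.charted
  refine ⟨fun x hx => ContinuousAt.continuousWithinAt (h x hx).tendsto, fun e he e' he' n => ?_⟩
  refine CnOn.of_local fun y hy => ?_
  obtain ⟨V, hV, hyV, hf⟩ := h _ hy.2.1
  have hV' : IsOpen V := hV
  refine ⟨_, ?_, ?_, hf.2 e he e' he' n⟩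
  · exact e.isOpen_inter_preimage_symm (hf.1.isOpen_inter_preimage hV' e'.open_source)
  · exact ⟨hy.1, hyV, hy.2.2⟩

theorem smooth_of_smoothAt {f : M₁ → M₂} (h : ∀ x, A.SmoothAt B f x) : A.Smooth B f :=
  smoothOn_of_smoothAt fun x _ => h x

theorem SmoothOn.congr {f g : M₁ → M₂} {U : Set M₁} (hU : A.IsOpenSet U)
    (h : A.SmoothOn B f U) (hfg : EqOn g f U) : A.SmoothOn B g U := by
  let := A.top
  let := B.top
  let := A.charted
  let := B.charted
  have hU' : IsOpen U := hU
  refine ⟨h.1.congr hfg, fun e he e' he' n => ?_⟩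
  have hset : e.target ∩ e.symm ⁻¹' (U ∩ g ⁻¹' e'.source) =
      e.target ∩ e.symm ⁻¹' (U ∩ f ⁻¹' e'.source) := by
    ext x
    simp only [mem_inter_iff, mem_preimage]
    refine and_congr_right fun _ => and_congr_right fun hx => ?_
    rw [hfg hx]
  rw [hset]
  refine CnOn.congr ?_ (h.2 e he e' he' n) fun x hx => ?_
  · exact e.isOpen_inter_preimage_symm (h.1.isOpen_inter_preimage hU' e'.open_source)
  · simp only [hfg hx.2.1]

theorem SmoothAt.congr {f g : M₁ → M₂} {x : M₁} (h : A.SmoothAt B f x)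
    (hfg : ∀ᶠ y in A.nhds x, g y = f y) : A.SmoothAt B g x := by
  obtain ⟨U, hU, hx, hf⟩ := h
  obtain ⟨V, hV, hVo, hxV⟩ := mem_nhds_iff.1 hfg
  exact ⟨U ∩ V, hU.inter hVo, ⟨hx, hxV⟩,
    (hf.mono inter_subset_left).congr (hU.inter hVo) fun y hy => hV hy.2⟩

theorem SmoothOn.comp {g : M₂ → M₃} {f : M₁ → M₂} {U : Set M₁} {V : Set M₂}
    (hg : B.SmoothOn C g V) (hf : A.SmoothOn B f U) (hU : A.IsOpenSet U) (hV : B.IsOpenSet V)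
    (h : MapsTo f U V) : A.SmoothOn C (fun x => g (f x)) U := by
  let := A.top
  let := B.top
  let := C.top
  let := A.charted
  let := B.charted
  let := C.charted
  have hU' : IsOpen U := hU
  have hV' : IsOpen V := hV
  refine ⟨ContinuousOn.comp hg.1 hf.1 h, fun e he e'' he'' n => ?_⟩
  refine CnOn.of_local fun y hy => ?_
  -- Near `y` the composite factors through a chart of the middle manifold at the image point, and
  -- there the chain rule applies.
  set e' := chartAt B.Model (f (e.symm y))
  have he' : e' ∈ atlas B.Model M₂ := chart_mem_atlas _ _
  have h₁ := hf.2 e he e' he' n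
  have h₂ := hg.2 e' he' e'' he'' n
  have hW : IsOpen (e.target ∩ e.symm ⁻¹' (U ∩ f ⁻¹' e'.source)) :=
    e.isOpen_inter_preimage_symm (hf.1.isOpen_inter_preimage hU' e'.open_source)
  have hW' : IsOpen (e'.target ∩ e'.symm ⁻¹' (V ∩ g ⁻¹' e''.source)) :=
    e'.isOpen_inter_preimage_symm (hg.1.isOpen_inter_preimage hV' e''.open_source)
  have hO := h₁.continuousOn.isOpen_inter_preimage hW hW'
  have hcomp := h₂.comp (h₁.mono inter_subset_left) hW' (fun x hx => hx.2) (U := _ ∩ _)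
  refine ⟨_, hO, ?_, hcomp.congr hO fun x hx => ?_⟩
  · have hys : f (e.symm y) ∈ e'.source := mem_chart_source _ _
    refine ⟨⟨hy.1, hy.2.1, hys⟩, e'.map_source hys, ?_⟩
    simp only [mem_preimage, e'.left_inv hys]
    exact ⟨h hy.2.1, hy.2.2⟩
  · simp only [e'.left_inv hx.1.2.2]

theorem SmoothAt.comp {g : M₂ → M₃} {f : M₁ → M₂} {x : M₁}
    (hg : B.SmoothAt C g (f x)) (hf : A.SmoothAt B f x) :
    A.SmoothAt C (fun x => g (f x)) x := by
  obtain ⟨V, hV, hxV, hg⟩ := hg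
  obtain ⟨U, hU, hxU, hf'⟩ := hf
  have hopen : A.IsOpenSet (U ∩ f ⁻¹' V) := by
    let := A.top
    let := B.top
    exact hf'.1.isOpen_inter_preimage hU hV
  exact ⟨_, hopen, ⟨hxU, hxV⟩, hg.comp (hf'.mono inter_subset_left) hopen hV fun y hy => hy.2⟩

/-- Composition, with the base point of the outer function given by an equation. -/
theorem SmoothAt.comp_of_eq {g : M₂ → M₃} {f : M₁ → M₂} {x : M₁} {y : M₂}
    (hg : B.SmoothAt C g y) (hf : A.SmoothAt B f x) (hy : f x = y) :
    A.SmoothAt C (fun x => g (f x)) x := by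
  subst hy
  exact hg.comp hf

theorem smooth_id : A.Smooth A (fun x => x) := by
  let := A.top
  let := A.charted
  refine ⟨continuousOn_id, fun e he e' he' n => (A.smooth_change e he e' he' n).mono ?_⟩
  rintro x ⟨hx, -, hx'⟩
  exact ⟨hx, hx'⟩

theorem smoothAt_id {x : M₁} : A.SmoothAt A (fun x => x) x :=
  smooth_id.smoothAt x

theorem smoothAt_const {c : M₂} {x : M₁} : A.SmoothAt B (fun _ => c) x := by
  let := A.top
  let := B.top
  exact ⟨univ, isOpenSet_univ, mem_univ _, continuousOn_const,
    fun e _ e' _ n => cnOn_const n (e' c) _⟩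

theorem smoothAt_fst {x : M₁ × M₂} : (A.prod B).SmoothAt A (fun x => x.1) x := by
  let := A.top
  let := B.top
  let := A.charted
  let := B.charted
  refine ⟨univ, isOpenSet_univ, mem_univ _, continuous_fst.continuousOn, ?_⟩
  rintro _ ⟨a, ha, b, hb, rfl⟩ a' ha' n
  refine ((A.smooth_change a ha a' ha' n).comp_linear
    (ContinuousLinearMap.fst 𝕜 A.Model B.Model)).mono ?_
  rintro ⟨x, y⟩ ⟨hx, -, hx'⟩
  exact ⟨hx.1, hx'⟩

theorem smoothAt_snd {x : M₁ × M₂} : (A.prod B).SmoothAt B (fun x => x.2) x := by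
  let := A.top
  let := B.top
  let := A.charted
  let := B.charted
  refine ⟨univ, isOpenSet_univ, mem_univ _, continuous_snd.continuousOn, ?_⟩
  rintro _ ⟨a, ha, b, hb, rfl⟩ b' hb' n
  refine ((B.smooth_change b hb b' hb' n).comp_linear
    (ContinuousLinearMap.snd 𝕜 A.Model B.Model)).mono ?_
  rintro ⟨x, y⟩ ⟨hx, -, hx'⟩
  exact ⟨hx.2, hx'⟩

theorem SmoothOn.prodMk {f : M₁ → M₂} {g : M₁ → M₃} {U : Set M₁}
    (hf : A.SmoothOn B f U) (hg : A.SmoothOn C g U) :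
    A.SmoothOn (B.prod C) (fun x => (f x, g x)) U := by
  let := A.top
  let := B.top
  let := C.top
  let := A.charted
  let := B.charted
  let := C.charted
  refine ⟨hf.1.prodMk hg.1, ?_⟩
  rintro e he _ ⟨b, hb, c, hc, rfl⟩ n
  refine ((hf.2 e he b hb n).mono ?_).prodMk ((hg.2 e he c hc n).mono ?_)
  · rintro x ⟨hx, hxU, hx'⟩
    exact ⟨hx, hxU, hx'.1⟩
  · rintro x ⟨hx, hxU, hx'⟩
    exact ⟨hx, hxU, hx'.2⟩

theorem SmoothAt.prodMk {f : M₁ → M₂} {g : M₁ → M₃} {x : M₁}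
    (hf : A.SmoothAt B f x) (hg : A.SmoothAt C g x) :
    A.SmoothAt (B.prod C) (fun x => (f x, g x)) x := by
  obtain ⟨U, hU, hx, hf⟩ := hf
  obtain ⟨V, hV, hxV, hg⟩ := hg
  exact ⟨U ∩ V, hU.inter hV, ⟨hx, hxV⟩,
    (hf.mono inter_subset_left).prodMk (hg.mono inter_subset_right)⟩

theorem SmoothAt.fst {f : M₁ → M₂ × M₃} {x : M₁} (hf : A.SmoothAt (B.prod C) f x) :
    A.SmoothAt B (fun x => (f x).1) x :=
  smoothAt_fst.comp hf

theorem SmoothAt.snd {f : M₁ → M₂ × M₃} {x : M₁} (hf : A.SmoothAt (B.prod C) f x) :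
    A.SmoothAt C (fun x => (f x).2) x :=
  smoothAt_snd.comp hf

/-! ### Gluing -/

/-- A manifold is obtained by gluing open subsets of a manifold along smooth transition maps. -/
theorem exists_glue (A : LCManifold.{u₁, w₁, v} 𝕜 M₁) {ι : Type*} (τ : ι → PartialEquiv M₂ M₁)
    (hcov : ∀ m, ∃ i, m ∈ (τ i).source)
    (hopen : ∀ i, A.IsOpenSet (τ i).target)
    (hmem : ∀ i j, ∀ x ∈ (τ i).target, (τ i).symm x ∈ (τ j).source →
      ∀ᶠ y in A.nhds x, (τ i).symm y ∈ (τ j).source)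
    (htrans : ∀ i j, ∀ x ∈ (τ i).target, (τ i).symm x ∈ (τ j).source →
      A.SmoothAt A (fun y => τ j ((τ i).symm y)) x)
    (hsep : ∀ m m', m ≠ m' → (∃ i, m ∈ (τ i).source ∧ m' ∈ (τ i).source) ∨
      ∃ i j, m ∈ (τ i).source ∧ m' ∈ (τ j).source ∧
        ∃ O O' : Set M₁, A.IsOpenSet O ∧ A.IsOpenSet O' ∧ τ i m ∈ O ∧ τ j m' ∈ O' ∧
          ∀ x ∈ O, ∀ x' ∈ O', (τ i).symm x ≠ (τ j).symm x') :
    ∃ L : LCManifold.{u₁, w₂, v} 𝕜 M₂, ∀ i,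
      L.IsOpenSet (τ i).source ∧
      (∀ m ∈ (τ i).source, L.SmoothAt A (τ i) m) ∧
      ∀ x ∈ (τ i).target, A.SmoothAt L (τ i).symm x := by
  let := A.top
  let := A.t2
  let := A.charted
  have hO : ∀ i j, IsOpen ((τ i).target ∩ (τ i).symm ⁻¹' (τ j).source) := fun i j =>
    isOpen_iff_mem_nhds.2 fun x hx =>
      inter_mem (IsOpen.mem_nhds (hopen i) hx.1) (hmem i j x hx.1 hx.2)
  have hsm : ∀ i j, A.SmoothOn A (fun y => τ j ((τ i).symm y))
      ((τ i).target ∩ (τ i).symm ⁻¹' (τ j).source) := fun i j =>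
    smoothOn_of_smoothAt fun x hx => htrans i j x hx.1 hx.2
  -- The domain of the transition from `τ i` to `τ j`, read in the charts `d` and `d'` of `A`. The
  -- new charts are the composites of `τ i` with charts of `A`.
  let T : ι → ι → OpenPartialHomeomorph M₁ A.Model → OpenPartialHomeomorph M₁ A.Model →
      Set A.Model := fun i j d d' => d.target ∩ d.symm ⁻¹'
        (((τ i).target ∩ (τ i).symm ⁻¹' (τ j).source) ∩
          (fun y => τ j ((τ i).symm y)) ⁻¹' d'.source)
  have hTo : ∀ i j d d', IsOpen (T i j d d') := fun i j d d' =>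
    d.isOpen_inter_preimage_symm ((hsm i j).1.isOpen_inter_preimage (hO i j) d'.open_source)
  have hTs : ∀ i j, ∀ d ∈ atlas A.Model M₁, ∀ d' ∈ atlas A.Model M₁,
      SmoothOnOpen 𝕜 (fun y => d' (τ j ((τ i).symm (d.symm y)))) (T i j d d') :=
    fun i j d hd d' hd' => (hsm i j).2 d hd d' hd'
  have hTeq : ∀ i j (d d' : OpenPartialHomeomorph M₁ A.Model),
      (((τ i).trans d.toPartialEquiv).symm.trans ((τ j).trans d'.toPartialEquiv)).source =
        T i j d d' := by
    intro i j d d'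
    ext y
    simp [T, PartialEquiv.trans_source, and_assoc, PartialEquiv.trans_target]
  choose idx hidx using hcov
  let c : ChartedSpaceCore A.Model M₂ :=
    { atlas := {e | ∃ i, ∃ d ∈ atlas A.Model M₁, e = (τ i).trans d.toPartialEquiv}
      chartAt := fun m => (τ (idx m)).trans (chartAt A.Model (τ (idx m) m)).toPartialEquiv
      mem_chart_source := fun m => by
        rw [PartialEquiv.trans_source]
        exact ⟨hidx m, mem_chart_source A.Model (τ (idx m) m)⟩
      chart_mem_atlas := fun m => ⟨_, _, chart_mem_atlas _ _, rfl⟩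
      open_source := by
        rintro _ _ ⟨i, d, hd, rfl⟩ ⟨j, d', hd', rfl⟩
        rw [hTeq]
        exact hTo i j d d'
      continuousOn_toFun := by
        rintro _ _ ⟨i, d, hd, rfl⟩ ⟨j, d', hd', rfl⟩
        rw [hTeq]
        exact hTs i j d hd d' hd' 0 }
  let tM : TopologicalSpace M₂ := c.toTopologicalSpace
  let cM : ChartedSpace A.Model M₂ := c.toChartedSpace
  -- The atlas of the core is a union of singletons of partial homeomorphisms; `hat` and `hat'`
  -- translate between these and the composites `d ∘ τ i`.
  have hat : ∀ e ∈ atlas A.Model M₂, ∃ i, ∃ d ∈ atlas A.Model M₁,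
      e.toPartialEquiv = (τ i).trans d.toPartialEquiv := by
    intro e he
    obtain ⟨e₀, he₀, h⟩ := mem_iUnion₂.1 he
    obtain ⟨i, d, hd, rfl⟩ := he₀
    rw [mem_singleton_iff] at h
    exact ⟨i, d, hd, by rw [h]; rfl⟩
  have hat' : ∀ i, ∀ d ∈ atlas A.Model M₁, ∃ e ∈ atlas A.Model M₂,
      e.toPartialEquiv = (τ i).trans d.toPartialEquiv := by
    intro i d hd
    have h : (τ i).trans d.toPartialEquiv ∈ c.atlas := ⟨i, d, hd, rfl⟩
    exact ⟨c.openPartialHomeomorph _ h, mem_iUnion₂.2 ⟨_, h, rfl⟩, rfl⟩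
  have hsrc : ∀ i, IsOpen (τ i).source ∧ ContinuousOn (τ i) (τ i).source := by
    intro i
    have key : ∀ m ∈ (τ i).source, (τ i).source ∈ 𝓝 m ∧ ContinuousAt (τ i) m := by
      intro m hm
      obtain ⟨e, -, he⟩ := hat' i _ (chart_mem_atlas A.Model (τ i m))
      set d := chartAt A.Model (τ i m)
      have hes : e.source = (τ i).source ∩ τ i ⁻¹' d.source :=
        (congrArg PartialEquiv.source he).trans (PartialEquiv.trans_source _ _)
      have hef : ∀ y, e y = d (τ i y) := fun y => congrArg (fun f : PartialEquiv _ _ => f y) he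
      have hme : m ∈ e.source := hes ▸ ⟨hm, mem_chart_source _ _⟩
      refine ⟨mem_of_superset (e.open_source.mem_nhds hme) (hes ▸ inter_subset_left), ?_⟩
      -- Near `m` the map `τ i` is recovered from the chart `e = d ∘ τ i` as `d.symm ∘ e`.
      have h₁ : ContinuousAt (fun y => d.symm (e y)) m := by
        refine ContinuousAt.comp ?_ (e.continuousAt hme)
        rw [hef]
        exact d.continuousAt_symm (d.map_source (mem_chart_source _ _))
      refine h₁.congr ?_
      filter_upwards [e.open_source.mem_nhds hme] with y hy
      have hy' : y ∈ (τ i).source ∩ τ i ⁻¹' d.source := hes ▸ hy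
      rw [hef, d.left_inv hy'.2]
    exact ⟨isOpen_iff_mem_nhds.2 fun m hm => (key m hm).1,
      fun m hm => (key m hm).2.continuousWithinAt⟩
  have htgt : ∀ i, ContinuousOn (τ i).symm (τ i).target := by
    intro i x hx
    refine ContinuousAt.continuousWithinAt ?_
    obtain ⟨e, -, he⟩ := hat' i _ (chart_mem_atlas A.Model x)
    set d := chartAt A.Model x
    have het : e.target = d.target ∩ d.symm ⁻¹' (τ i).target :=
      (congrArg PartialEquiv.target he).trans (PartialEquiv.trans_target _ _)
    have hef : ∀ y, e.symm y = (τ i).symm (d.symm y) := fun y =>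
      congrArg (fun f : PartialEquiv _ _ => f.symm y) he
    have hxd : x ∈ d.source := mem_chart_source _ _
    have h₁ : ContinuousAt (fun y => e.symm (d y)) x := by
      refine ContinuousAt.comp (e.continuousAt_symm ?_) (d.continuousAt hxd)
      rw [het]
      refine ⟨d.map_source hxd, ?_⟩
      rw [mem_preimage, d.left_inv hxd]
      exact hx
    refine h₁.congr ?_
    filter_upwards [d.open_source.mem_nhds hxd] with y hy
    rw [hef, d.left_inv hy]
  have hT2 : T2Space M₂ := by
    refine ⟨fun m m' hne => ?_⟩
    rcases hsep m m' hne with ⟨i, hm, hm'⟩ | ⟨i, j, hm, hm', O, O', hOo, hOo', hmO, hmO', hd⟩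
    · obtain ⟨O, O', hOo, hOo', hmO, hmO', hd⟩ :=
        t2_separation fun h => hne ((τ i).injOn hm hm' h)
      refine ⟨_, _, (hsrc i).2.isOpen_inter_preimage (hsrc i).1 hOo,
        (hsrc i).2.isOpen_inter_preimage (hsrc i).1 hOo', ⟨hm, hmO⟩, ⟨hm', hmO'⟩, ?_⟩
      refine Set.disjoint_left.2 fun z hz hz' => ?_
      exact Set.disjoint_left.1 hd hz.2 hz'.2
    · refine ⟨_, _, (hsrc i).2.isOpen_inter_preimage (hsrc i).1 hOo,
        (hsrc j).2.isOpen_inter_preimage (hsrc j).1 hOo', ⟨hm, hmO⟩, ⟨hm', hmO'⟩, ?_⟩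
      refine Set.disjoint_left.2 fun z hz hz' => hd _ hz.2 _ hz'.2 ?_
      rw [(τ i).left_inv hz.1, (τ j).left_inv hz'.1]
  let L : LCManifold.{u₁, w₂, v} 𝕜 M₂ :=
    { Model := A.Model
      top := tM
      t2 := hT2
      charted := cM
      smooth_change := by
        intro e he e' he'
        obtain ⟨i, d, hd, h⟩ := hat e he
        obtain ⟨j, d', hd', h'⟩ := hat e' he'
        have hfun : (fun x => e' (e.symm x)) = fun y => d' (τ j ((τ i).symm (d.symm y))) := by
          funext y
          change e'.toPartialEquiv (e.toPartialEquiv.symm y) = _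
          rw [h, h']
          rfl
        have hs : (e.symm.trans e').source = T i j d d' := by
          rw [← hTeq, ← h, ← h']
          rfl
        rw [hfun, hs]
        exact hTs i j d hd d' hd' }
  refine ⟨L, fun i => ⟨(hsrc i).1, fun m hm => ⟨_, (hsrc i).1, hm, (hsrc i).2, ?_⟩,
    fun x hx => ⟨_, hopen i, hx, htgt i, ?_⟩⟩⟩
  · intro e he d' hd' n
    obtain ⟨j, d, hd, h⟩ := hat e he
    have hfun : (fun x => d' (τ i (e.symm x))) =
        fun y => d' (τ i ((τ j).symm (d.symm y))) := by
      funext y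
      change d' (τ i (e.toPartialEquiv.symm y)) = _
      rw [h]
      rfl
    rw [hfun]
    refine (hTs j i d hd d' hd' n).mono ?_
    rintro y ⟨hy, hy'⟩
    change y ∈ e.toPartialEquiv.target at hy
    change e.toPartialEquiv.symm y ∈ (τ i).source ∩ τ i ⁻¹' d'.source at hy'
    rw [h] at hy hy'
    rw [PartialEquiv.trans_target] at hy
    exact ⟨hy.1, ⟨hy.2, hy'.1⟩, hy'.2⟩
  · intro d hd e he n
    obtain ⟨j, d', hd', h⟩ := hat e he
    have hfun : (fun x => e ((τ i).symm (d.symm x))) =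
        fun y => d' (τ j ((τ i).symm (d.symm y))) := by
      funext y
      change e.toPartialEquiv _ = _
      rw [h]
      rfl
    rw [hfun]
    refine (hTs i j d hd d' hd' n).mono ?_
    rintro y ⟨hy, hy', hy''⟩
    change (τ i).symm (d.symm y) ∈ e.toPartialEquiv.source at hy''
    rw [h, PartialEquiv.trans_source] at hy''
    exact ⟨hy, ⟨hy', hy''.1⟩, hy''.2⟩

/-- Transport of a manifold structure along a bijection. -/
theorem exists_diffeo (A : LCManifold.{u₁, w₁, v} 𝕜 M₁) (e : M₂ ≃ M₁) :
    ∃ L : LCManifold.{u₁, w₂, v} 𝕜 M₂, L.Diffeo A e := by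
  obtain ⟨L, hL⟩ := A.exists_glue (fun _ : Unit => e.toPartialEquiv)
    (fun _ => ⟨(), mem_univ _⟩) (fun _ => isOpenSet_univ)
    (fun _ _ _ _ _ => Eventually.of_forall fun _ => mem_univ _)
    (fun _ _ x _ _ => by simpa using smoothAt_id)
    (fun _ _ _ => Or.inl ⟨(), mem_univ _, mem_univ _⟩)
  exact ⟨L, smooth_of_smoothAt fun m => (hL ()).2.1 m (mem_univ _),
    smooth_of_smoothAt fun x => (hL ()).2.2 x (mem_univ _)⟩

end LCManifold

/-! ## Lie groups from local data -/

namespace LCManifold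

universe w₁ w₂ w₃ w₄
variable {𝕜 : Type u₁} [RCLike 𝕜]

theorem Smooth.isOpenSet_preimage {M₁ : Type w₁} {M₂ : Type w₂}
    {A : LCManifold.{u₁, w₁, v} 𝕜 M₁} {B : LCManifold.{u₁, w₂, v} 𝕜 M₂} {f : M₁ → M₂}
    (hf : A.Smooth B f) {U : Set M₂} (hU : B.IsOpenSet U) : A.IsOpenSet (f ⁻¹' U) :=
  isOpenSet_iff.2 fun x hx => (hf.smoothAt x).tendsto (hU.mem_nhds hx)

variable {M : Type w₁} {G : Type w₂} [Group G] {H : Type w₃} [Group H]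
  {D : LCManifold.{u₁, w₁, v} 𝕜 M}
  {A : LCManifold.{u₁, w₂, v} 𝕜 G} {B : LCManifold.{u₁, w₃, v} 𝕜 H}

theorem IsLieGroup.mul (hA : A.IsLieGroup) {f g : M → G} {x : M}
    (hf : D.SmoothAt A f x) (hg : D.SmoothAt A g x) : D.SmoothAt A (fun x => f x * g x) x :=
  (hA.smooth_mul.smoothAt (f x, g x)).comp_of_eq (hf.prodMk hg) rfl

theorem IsLieGroup.inv (hA : A.IsLieGroup) {f : M → G} {x : M}
    (hf : D.SmoothAt A f x) : D.SmoothAt A (fun x => (f x)⁻¹) x :=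
  (hA.smooth_inv.smoothAt (f x)).comp hf

/-- A homomorphism of Lie groups that is smooth near the identity is smooth. -/
theorem IsLieGroup.smooth_hom (hA : A.IsLieGroup) (hB : B.IsLieGroup) (f : G →* H)
    (hf : A.SmoothAt B f 1) : A.Smooth B f := by
  refine smooth_of_smoothAt fun x => ?_
  -- Translation to the identity: `f y = f x * f (x⁻¹ * y)`.
  have h₁ : A.SmoothAt A (fun y => x⁻¹ * y) x := hA.mul smoothAt_const smoothAt_id
  have h₂ : A.SmoothAt B (fun y => f x * f (x⁻¹ * y)) x :=
    hB.mul smoothAt_const (hf.comp_of_eq h₁ (inv_mul_cancel x))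
  refine h₂.congr (Eventually.of_forall fun y => ?_)
  rw [← map_mul, mul_inv_cancel_left]

/-- A group with a manifold structure for which multiplication, inversion, and all conjugations are
smooth near the identity carries a Lie group structure which agrees with the given manifold
structure near the identity. -/
theorem exists_isLieGroup (A : LCManifold.{u₁, w₂, v} 𝕜 G)
    (hm : (A.prod A).SmoothAt A (fun p => p.1 * p.2) (1, 1))
    (hi : A.SmoothAt A (fun x => x⁻¹) 1)
    (hc : ∀ k : G, A.SmoothAt A (fun x => k * x * k⁻¹) 1) :
    ∃ L : LCManifold.{u₁, w₂, v} 𝕜 G, L.IsLieGroup ∧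
      A.SmoothAt L (fun x => x) 1 ∧ L.SmoothAt A (fun x => x) 1 := by
  -- Near `z`, left translation by `w` is `x ↦ z⁻¹ * x` followed by `y ↦ (w * z) * y`. The two
  -- conditions, applied at `z` and at `w * z`, make these factors smooth.
  set P : G → Prop := fun z => (A.prod A).SmoothAt A (fun p => p.1 * p.2) (z⁻¹, z) ∧
    (A.prod A).SmoothAt A (fun p => p.1 * p.2) (z, 1)
  have hP : ∀ᶠ z in A.nhds 1, P z := by
    have h₁ : Tendsto (fun z : G => (z⁻¹, z)) (A.nhds 1) ((A.prod A).nhds (1, 1)) := by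
      have := (hi.prodMk (smoothAt_id (A := A) (x := 1))).tendsto
      simpa using this
    have h₂ : Tendsto (fun z : G => (z, (1 : G))) (A.nhds 1) ((A.prod A).nhds (1, 1)) :=
      (smoothAt_id.prodMk smoothAt_const : A.SmoothAt (A.prod A) _ 1).tendsto
    exact (h₁.eventually hm.eventually).and (h₂.eventually hm.eventually)
  set V : Set G := {z | ∀ᶠ y in A.nhds z, P y}
  have hV : A.IsOpenSet V := A.isOpenSet_setOf_eventually P
  have hV1 : (1 : G) ∈ V := hP
  have hVP : ∀ z ∈ V, P z := fun z hz => eventually_self hz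
  have hleft : ∀ w z : G, z ∈ V → w * z ∈ V → A.SmoothAt A (fun x => w * x) z := by
    intro w z hz hwz
    have h₁ : A.SmoothAt A (fun x => z⁻¹ * x) z :=
      (hVP z hz).1.comp_of_eq (smoothAt_const.prodMk smoothAt_id) rfl
    have h₂ : A.SmoothAt A (fun y => (w * z) * y) 1 :=
      (hVP _ hwz).2.comp_of_eq (smoothAt_const.prodMk smoothAt_id) rfl
    refine (h₂.comp_of_eq h₁ (inv_mul_cancel z)).congr (Eventually.of_forall fun x => ?_)
    simp [mul_assoc]
  -- The new manifold is glued from the left translates of `V`; the transition maps are left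
  -- translations between points of `V`, smooth by `hleft`.
  let τ : G → PartialEquiv G G := fun k =>
    { toFun := fun x => k⁻¹ * x
      invFun := fun z => k * z
      source := {x | k⁻¹ * x ∈ V}
      target := V
      map_source' := fun x hx => hx
      map_target' := fun z hz => by simpa using hz
      left_inv' := fun x _ => by simp
      right_inv' := fun z _ => by simp }
  obtain ⟨L, hL⟩ := A.exists_glue τ (fun m => ⟨m, by simpa [τ] using hV1⟩) (fun _ => hV)
    (by
      intro k k' x hx hx'
      have hx'' : k'⁻¹ * k * x ∈ V := by simpa [τ, mul_assoc] using hx'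
      filter_upwards [(hleft _ x hx hx'').tendsto (hV.mem_nhds hx'')] with y hy
      simpa [τ, mul_assoc] using hy)
    (by
      intro k k' x hx hx'
      have hx'' : k'⁻¹ * k * x ∈ V := by simpa [τ, mul_assoc] using hx'
      refine (hleft _ x hx hx'').congr (Eventually.of_forall fun y => ?_)
      simp [τ, mul_assoc])
    (by
      intro m m' _
      -- If `m⁻¹ * m'` lies in `V`, both points lie in the translate of `V` by `m`. Otherwise take
      -- `O` near `1` with `x * x'⁻¹ ∈ V` on `O`: a common point of the translates of `O` by `m` and
      -- `m'` would put `m⁻¹ * m'` in `V`.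
      by_cases hmm : m⁻¹ * m' ∈ V
      · exact Or.inl ⟨m, by simpa [τ] using hV1, hmm⟩
      · refine Or.inr ⟨m, m', by simpa [τ] using hV1, by simpa [τ] using hV1, ?_⟩
        have hdiv : (A.prod A).SmoothAt A (fun p => p.1 * p.2⁻¹) (1, 1) :=
          hm.comp_of_eq (smoothAt_fst.prodMk (hi.comp_of_eq smoothAt_snd rfl)) (by simp)
        have hmem := hdiv.tendsto (hV.mem_nhds (by simpa using hV1))
        rw [nhds_prod, mem_map, mem_prod_same_iff] at hmem
        obtain ⟨t, ht, hts⟩ := hmem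
        obtain ⟨O, hOt, hO, h1O⟩ := mem_nhds_iff.1 ht
        refine ⟨O, O, hO, hO, by simpa [τ] using h1O, by simpa [τ] using h1O, ?_⟩
        intro x hx x' hx' h
        refine hmm ?_
        have h' : m * x = m' * x' := h
        have h'' : m⁻¹ * m' = x * x'⁻¹ := by
          rw [inv_mul_eq_iff_eq_mul, ← mul_assoc, h', mul_inv_cancel_right]
        rw [h'']
        exact hts (mk_mem_prod (hOt hx) (hOt hx')))
  have hLA : ∀ m : G, L.SmoothAt A (fun x => m⁻¹ * x) m := fun m =>
    (hL m).2.1 m (by simpa [τ] using hV1)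
  have hAL : ∀ m : G, A.SmoothAt L (fun x => m * x) 1 := fun m => (hL m).2.2 1 hV1
  refine ⟨L, ⟨smooth_of_smoothAt ?_, smooth_of_smoothAt fun x => ?_⟩,
    by simpa using hAL 1, by simpa using hLA 1⟩
  · rintro ⟨x, y⟩
    -- In translated coordinates $(xy)^{-1}x'y'=\big(y^{-1}(x^{-1}x')y\big)(y^{-1}y')$: a
    -- conjugation followed by a product near the identity. Inversion below is handled by
    -- $x'^{-1}=x^{-1}\cdot x(x^{-1}x')^{-1}x^{-1}$.
    have hx : (L.prod L).SmoothAt A (fun p => y⁻¹ * (x⁻¹ * p.1) * y⁻¹⁻¹) (x, y) :=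
      (hc y⁻¹).comp_of_eq ((hLA x).comp_of_eq smoothAt_fst rfl) (by simp)
    have hy : (L.prod L).SmoothAt A (fun p => y⁻¹ * p.2) (x, y) :=
      (hLA y).comp_of_eq smoothAt_snd rfl
    have hxy := hm.comp_of_eq (hx.prodMk hy) (by simp)
    refine ((hAL (x * y)).comp_of_eq hxy (by simp)).congr (Eventually.of_forall fun p => ?_)
    simp [mul_assoc]
  · have hx : L.SmoothAt A (fun y => x * (x⁻¹ * y)⁻¹ * x⁻¹) x :=
      (hc x).comp_of_eq (hi.comp_of_eq (hLA x) (by simp)) (by simp)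
    refine ((hAL x⁻¹).comp_of_eq hx (by simp)).congr (Eventually.of_forall fun p => ?_)
    simp [mul_assoc]

end LCManifold

/-! ## Principal bundles -/

section Bundles

universe w₁ w₂ w₃ w₄
open LCManifold

variable {𝕜 : Type u₁} [RCLike 𝕜]
  {H : Type w₁} [Group H] {P : Type w₂} [Group P] {X : Type w₃}
  {A : LCManifold.{u₁, w₁, v} 𝕜 H} {B : LCManifold.{u₁, w₂, v} 𝕜 P}
  {C : LCManifold.{u₁, w₃, v} 𝕜 X} {i : H →* P}

/-- There are smooth local sections through each point. -/
theorem IsPrincipalBundle.exists_section {π : P → X} (h : IsPrincipalBundle A B C i π)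
    (hB : B.IsLieGroup) (p : P) :
    ∃ s : X → P, C.SmoothAt B s (π p) ∧ s (π p) = p ∧ ∀ᶠ y in C.nhds (π p), π (s y) = y := by
  obtain ⟨V, hV, hpV, s, hs, hπ, -⟩ := h.locally_trivial (π p)
  -- A given local section need not pass through `p`; translating it by the structure group corrects
  -- its value.
  obtain ⟨k, hk⟩ := (h.fiber (s (π p)) p).1 (hπ _ hpV)
  refine ⟨fun y => s y * i k, hB.mul (hs.smoothAt hV hpV) smoothAt_const, hk.symm, ?_⟩
  filter_upwards [hV.mem_nhds hpV] with y hy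
  rw [← (h.fiber (s y) (s y * i k)).2 ⟨k, rfl⟩]
  exact hπ y hy

/-- A map on the base is smooth if its pull-back to the total space is smooth. -/
theorem IsPrincipalBundle.smoothAt_base {π : P → X} (h : IsPrincipalBundle A B C i π)
    (hB : B.IsLieGroup) {Y : Type w₄} {D : LCManifold.{u₁, w₄, v} 𝕜 Y} {f : X → Y} {p : P}
    (hf : B.SmoothAt D (fun p => f (π p)) p) : C.SmoothAt D f (π p) := by
  obtain ⟨s, hs, hsp, hπ⟩ := h.exists_section hB p
  refine (hf.comp_of_eq hs hsp).congr ?_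
  filter_upwards [hπ] with y hy
  rw [hy]

/-- The base of a principal bundle is determined by the total space and the fibres. -/
theorem IsPrincipalBundle.diffeo_base {π : P → X} (h : IsPrincipalBundle A B C i π)
    (hB : B.IsLieGroup) {H' : Type*} [Group H'] {X' : Type w₄} {A' : LCManifold 𝕜 H'}
    {C' : LCManifold.{u₁, w₄, v} 𝕜 X'} {i' : H' →* P} {π' : P → X'}
    (h' : IsPrincipalBundle A' B C' i' π') (e : X ≃ X') (he : ∀ p, e (π p) = π' p) :
    C.Diffeo C' e := by
  refine ⟨smooth_of_smoothAt fun x => ?_, smooth_of_smoothAt fun x => ?_⟩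
  · obtain ⟨V, -, hxV, s, -, hπ, -⟩ := h.locally_trivial x
    rw [← hπ x hxV]
    refine h.smoothAt_base hB ?_
    simp only [he]
    exact h'.smooth_proj.smoothAt _
  · obtain ⟨V, -, hxV, s, -, hπ, -⟩ := h'.locally_trivial x
    rw [← hπ x hxV]
    refine h'.smoothAt_base hB ?_
    simp only [← he, Equiv.symm_apply_apply]
    exact h.smooth_proj.smoothAt _

/-- Transport of a principal bundle along a change of the structure group and of the base. -/
theorem IsPrincipalBundle.transport {π : P → X} (h : IsPrincipalBundle A B C i π)
    {H' : Type*} [Group H'] {X' : Type w₄} {A' : LCManifold 𝕜 H'}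
    {C' : LCManifold.{u₁, w₄, v} 𝕜 X'} (e : H' ≃* H) (he : A'.Diffeo A e.toEquiv)
    (f : X' ≃ X) (hf : C'.Diffeo C f) {i' : H' →* P} {π' : P → X'}
    (hi : ∀ x, i' x = i (e x)) (hπ : ∀ p, f (π' p) = π p) :
    IsPrincipalBundle A' B C' i' π' where
  smooth_incl := smooth_of_smoothAt fun x => by
    refine ((h.smooth_incl.smoothAt _).comp (he.1.smoothAt x)).congr
      (Eventually.of_forall fun y => hi y)
  smooth_proj := smooth_of_smoothAt fun p => by
    refine ((hf.2.smoothAt _).comp (h.smooth_proj.smoothAt p)).congr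
      (Eventually.of_forall fun y => ?_)
    rw [← hπ, Equiv.symm_apply_apply]
  free x y hxy := e.injective (h.free (by rw [← hi, ← hi, hxy]))
  fiber p p' := by
    rw [← f.injective.eq_iff, hπ, hπ, h.fiber]
    refine ⟨fun ⟨k, hk⟩ => ⟨e.symm k, ?_⟩, fun ⟨k, hk⟩ => ⟨e k, ?_⟩⟩
    · rw [hi, e.apply_symm_apply, hk]
    · rw [← hi, hk]
  locally_trivial x := by
    obtain ⟨V, hV, hxV, s, hs, hsπ, d, hd, hsd⟩ := h.locally_trivial (f x)
    have hpre : π' ⁻¹' (f ⁻¹' V) = π ⁻¹' V := by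
      ext p
      simp only [mem_preimage, hπ]
    refine ⟨f ⁻¹' V, hf.1.isOpenSet_preimage hV, hxV, fun y => s (f y), ?_, fun y hy => ?_,
      fun p => e.symm (d p), ?_, fun p hp => ?_⟩
    · exact smoothOn_of_smoothAt fun y hy => (hs.smoothAt hV hy).comp (hf.1.smoothAt y)
    · exact f.injective (by rw [hπ, hsπ _ hy])
    · rw [hpre]
      exact smoothOn_of_smoothAt fun p hp => (he.2.smoothAt _).comp
        (hd.smoothAt (h.smooth_proj.isOpenSet_preimage hV) hp)
    · beta_reduce
      rw [hi, e.apply_symm_apply, hπ]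
      exact hsd p (by rw [← hπ]; exact hp)

/-- An exact sequence of Lie groups with a section smooth near the identity, and a retraction onto
the kernel which is smooth near the kernel, is a principal bundle. -/
theorem isPrincipalBundle_of_section {G : Type w₃} [Group G] {C : LCManifold.{u₁, w₃, v} 𝕜 G}
    (hB : B.IsLieGroup) (hC : C.IsLieGroup) {q : P →* G}
    (hi : A.Smooth B i) (hq : B.Smooth C q) (hinj : Function.Injective i)
    (hexact : ∀ p, q p = 1 ↔ ∃ k, p = i k)
    {s : G → P} (hs : C.SmoothAt B s 1) (hqs : ∀ y, q (s y) = y)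
    {r : P → H} (hr : ∀ k, r (i k) = k) (hrs : ∀ k, B.SmoothAt A r (i k)) :
    IsPrincipalBundle A B C i q where
  smooth_incl := hi
  smooth_proj := hq
  free := hinj
  fiber p p' := by
    rw [eq_comm, ← inv_mul_eq_one, ← map_inv, ← map_mul, hexact]
    constructor
    · rintro ⟨k, hk⟩
      exact ⟨k⁻¹, by rw [map_inv, ← hk]; group⟩
    · rintro ⟨k, rfl⟩
      exact ⟨k⁻¹, by rw [map_inv]; group⟩
  locally_trivial x := by
    have htr : C.Smooth C (fun y => x⁻¹ * y) :=
      smooth_of_smoothAt fun y => hC.mul smoothAt_const smoothAt_id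
    -- The section near `x` is `y ↦ s x * s (x⁻¹ * y)`, where `s x` is only a constant, so
    -- smoothness of `s` near `1` suffices. Dividing by it moves a point into the kernel, where `r`
    -- is smooth.
    set V : Set G := (fun y => x⁻¹ * y) ⁻¹' {z | ∀ᶠ y in C.nhds z, C.SmoothAt B s y}
    have hV : C.IsOpenSet V := htr.isOpenSet_preimage (C.isOpenSet_setOf_eventually _)
    have hsV : ∀ y ∈ V, C.SmoothAt B (fun y => s x * s (x⁻¹ * y)) y := fun y hy =>
      hB.mul smoothAt_const
        ((eventually_self (p := fun y => C.SmoothAt B s y) hy).comp (htr.smoothAt y))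
    have hπs : ∀ y, q (s x * s (x⁻¹ * y)) = y := fun y => by simp [hqs]
    have hker : ∀ p, ∃ k, (s x * s (x⁻¹ * q p))⁻¹ * p = i k := fun p =>
      (hexact _).1 (by rw [map_mul, map_inv, hπs, inv_mul_cancel])
    refine ⟨V, hV, ?_, fun y => s x * s (x⁻¹ * y), smoothOn_of_smoothAt hsV, fun y _ => hπs y,
      fun p => r ((s x * s (x⁻¹ * q p))⁻¹ * p), smoothOn_of_smoothAt fun p hp => ?_,
      fun p _ => ?_⟩
    · change ∀ᶠ y in C.nhds (x⁻¹ * x), C.SmoothAt B s y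
      rw [inv_mul_cancel]
      exact hs.eventually
    · obtain ⟨k, hk⟩ := hker p
      exact (hrs k).comp_of_eq
        (hB.mul (hB.inv ((hsV _ hp).comp (hq.smoothAt p))) smoothAt_id) hk
    · obtain ⟨k, hk⟩ := hker p
      beta_reduce
      rw [hk, hr, ← hk, mul_inv_cancel_left]

/-- The quotient of a Lie group by a normal split Lie subgroup is a Lie group. -/
theorem SplitLieSubgroup.quot_isLieGroup (hB : B.IsLieGroup) {K : Subgroup P} [K.Normal]
    (Z : SplitLieSubgroup B K) : Z.quot.IsLieGroup where
  smooth_mul := smooth_of_smoothAt fun x => by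
    obtain ⟨a, b⟩ := x
    induction a using QuotientGroup.induction_on with | H a => ?_
    induction b using QuotientGroup.induction_on with | H b => ?_
    obtain ⟨s, hs, -, hπs⟩ := Z.bundle.exists_section hB a
    obtain ⟨t, ht, -, hπt⟩ := Z.bundle.exists_section hB b
    have hst : (Z.quot.prod Z.quot).SmoothAt B (fun p => s p.1 * t p.2)
        ((a : P ⧸ K), (b : P ⧸ K)) :=
      hB.mul (hs.comp_of_eq smoothAt_fst rfl) (ht.comp_of_eq smoothAt_snd rfl)
    refine ((Z.bundle.smooth_proj.smoothAt _).comp hst).congr ?_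
    rw [nhds_prod]
    filter_upwards [hπs.prod_mk hπt] with p hp
    rw [QuotientGroup.mk_mul, hp.1, hp.2]
  smooth_inv := smooth_of_smoothAt fun a => by
    induction a using QuotientGroup.induction_on with | H a => ?_
    refine Z.bundle.smoothAt_base hB (f := fun x : P ⧸ K => x⁻¹) ?_
    exact (Z.bundle.smooth_proj.smoothAt _).comp (hB.smooth_inv.smoothAt a)

/-- A Lie group structure is transported along a diffeomorphic isomorphism of groups. -/
theorem LCManifold.IsLieGroup.of_diffeo {H' : Type w₄} [Group H'] {A' : LCManifold 𝕜 H'}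
    (hA : A.IsLieGroup) (e : H' ≃* H) (he : A'.Diffeo A e.toEquiv) : A'.IsLieGroup where
  smooth_mul := smooth_of_smoothAt fun x => by
    have h₁ : (A'.prod A').SmoothAt A (fun p => e p.1 * e p.2) x :=
      hA.mul ((he.1.smoothAt _).comp smoothAt_fst) ((he.1.smoothAt _).comp smoothAt_snd)
    refine ((he.2.smoothAt _).comp h₁).congr (Eventually.of_forall fun p => ?_)
    rw [← map_mul]
    exact (e.symm_apply_apply _).symm
  smooth_inv := smooth_of_smoothAt fun x => by
    refine ((he.2.smoothAt _).comp (hA.inv (he.1.smoothAt x))).congr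
      (Eventually.of_forall fun p => ?_)
    exact ((congrArg e.symm (map_inv e p).symm).trans (e.symm_apply_apply _)).symm

end Bundles

/-! ## Smoothness of outer actions -/

section OuterActions

open LCManifold

variable {𝕜 : Type u₁} [RCLike 𝕜]

theorem mulAut_conj_apply_eq {N : Type*} [Group N] (f : MulAut N) (n : N) :
    MulAut.conj (f n) = f * MulAut.conj n * f⁻¹ := by
  ext m
  simp

section LieAut

variable {N : Type u₃} [Group N] {B : LCManifold.{u₁, u₃, v} 𝕜 N}

theorem IsLieAut.smoothAt {φ : MulAut N} (h : IsLieAut B φ) (n : N) : B.SmoothAt B φ n :=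
  h.1.smoothAt n

theorem IsLieAut.mul {φ ψ : MulAut N} (hφ : IsLieAut B φ) (hψ : IsLieAut B ψ) :
    IsLieAut B (φ * ψ) :=
  ⟨smooth_of_smoothAt fun n => (hφ.1.smoothAt _).comp (hψ.1.smoothAt n),
    smooth_of_smoothAt fun n => (hψ.2.smoothAt _).comp (hφ.2.smoothAt n)⟩

theorem isLieAut_conj (hB : B.IsLieGroup) (n : N) : IsLieAut B (MulAut.conj n) := by
  have key : ∀ n : N, B.Smooth B (fun m => n * m * n⁻¹) := fun n =>
    smooth_of_smoothAt fun m => hB.mul (hB.mul smoothAt_const smoothAt_id) smoothAt_const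
  refine ⟨key n, ?_⟩
  have h : (⇑(MulAut.conj n).toEquiv.symm : N → N) = fun m => n⁻¹ * m * n⁻¹⁻¹ := by
    funext m
    simp
  rw [h]
  exact key n⁻¹

/-- The action of `N ⧸ Z(N)` on `N` by conjugation is smooth. -/
theorem smoothAt_conjAd (hB : B.IsLieGroup) (Z : SplitLieSubgroup B (Subgroup.center N))
    (p : (N ⧸ Subgroup.center N) × N) :
    (Z.quot.prod B).SmoothAt B (fun p => conjAd p.1 p.2) p := by
  obtain ⟨a, n⟩ := p
  induction a using QuotientGroup.induction_on with | H m => ?_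
  obtain ⟨s, hs, -, hπ⟩ := Z.bundle.exists_section hB m
  have hs' : (Z.quot.prod B).SmoothAt B (fun p => s p.1) ((m : N ⧸ Subgroup.center N), n) :=
    hs.comp_of_eq smoothAt_fst rfl
  have h₁ : (Z.quot.prod B).SmoothAt B (fun p => s p.1 * p.2 * (s p.1)⁻¹)
      ((m : N ⧸ Subgroup.center N), n) :=
    hB.mul (hB.mul hs' smoothAt_snd) (hB.inv hs')
  refine h₁.congr ?_
  have hev := (smoothAt_fst (A := Z.quot) (B := B)
    (x := ((m : N ⧸ Subgroup.center N), n))).tendsto.eventually hπ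
  filter_upwards [hev] with p hp
  conv_lhs => rw [← hp]
  rfl

end LieAut

namespace SmoothOuterAction

variable {G : Type u₂} [Group G] {N : Type u₃} [Group N]
  {A : LCManifold.{u₁, u₂, v} 𝕜 G} {B : LCManifold.{u₁, u₃, v} 𝕜 N}
  {S S' : SmoothOuterAction A B} {Z : SplitLieSubgroup B (Subgroup.center N)}

/-! ### Local smoothness of the data defining the product of $G^S$. -/

theorem eventually_smoothAt_toFun (S : SmoothOuterAction A B) :
    ∀ᶠ u in A.nhds 1, ∀ n, (A.prod B).SmoothAt B (fun p => S.toFun p.1 p.2) (u, n) := by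
  obtain ⟨U, hU, h1, hS⟩ := S.locally_smooth
  filter_upwards [hU.mem_nhds h1] with u hu n
  exact hS.smoothAt (hU.prod isOpenSet_univ) ⟨hu, mem_univ n⟩

theorem smoothAt_toFun_one (S : SmoothOuterAction A B) (n : N) :
    (A.prod B).SmoothAt B (fun p => S.toFun p.1 p.2) (1, n) :=
  eventually_self S.eventually_smoothAt_toFun n

/-- Since `conjAd` is injective, $\delta_S$ determines $\omega$ modulo the center. Hence neither the
chosen cochain in `deltaAd` nor any other choice of $\omega$ affects the product. -/
theorem deltaAd_eq {ω : G × G → N}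
    (hω : ∀ g g', delta S.toFun g g' = MulAut.conj (ω (g, g'))) (g g' : G) :
    S.deltaAd g g' = (ω (g, g') : N ⧸ Subgroup.center N) :=
  conjAd_injective (by rw [conjAd_deltaAd, hω]; rfl)

theorem smoothAt_mk (Z : SplitLieSubgroup B (Subgroup.center N)) (n : N) :
    B.SmoothAt Z.quot (fun n => (n : N ⧸ Subgroup.center N)) n :=
  Z.bundle.smooth_proj.smoothAt n

/-- The argument in $N_{\rm ad}$ is lifted to $N$ by a smooth local section, where the local
smoothness of $S$ applies. -/
theorem smoothAt_actAd_one (hB : B.IsLieGroup) (S : SmoothOuterAction A B)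
    (Z : SplitLieSubgroup B (Subgroup.center N)) (a : N ⧸ Subgroup.center N) :
    (A.prod Z.quot).SmoothAt Z.quot (fun p => S.actAd p.1 p.2) (1, a) := by
  induction a using QuotientGroup.induction_on with | H n => ?_
  obtain ⟨s, hs, -, hπ⟩ := Z.bundle.exists_section hB n
  have hs' : (A.prod Z.quot).SmoothAt B (fun p => s p.2) (1, (n : N ⧸ Subgroup.center N)) :=
    hs.comp_of_eq smoothAt_snd rfl
  refine ((smoothAt_mk Z _).comp ((S.smoothAt_toFun_one _).comp_of_eq
    (smoothAt_fst.prodMk hs') rfl)).congr ?_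
  have hev := (smoothAt_snd (A := A) (B := Z.quot)
    (x := (1, (n : N ⧸ Subgroup.center N)))).tendsto.eventually hπ
  filter_upwards [hev] with p hp
  conv_lhs => rw [← hp]
  rfl

theorem smoothAt_actAd (hB : B.IsLieGroup) (S : SmoothOuterAction A B)
    (Z : SplitLieSubgroup B (Subgroup.center N)) (g : G) (a : N ⧸ Subgroup.center N) :
    Z.quot.SmoothAt Z.quot (S.actAd g) a := by
  induction a using QuotientGroup.induction_on with | H n => ?_
  refine Z.bundle.smoothAt_base hB (f := S.actAd g) (p := n) ?_
  exact (smoothAt_mk Z _).comp ((S.lieAut g).smoothAt n)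

theorem smoothAt_deltaAd (S : SmoothOuterAction A B)
    (Z : SplitLieSubgroup B (Subgroup.center N)) :
    (A.prod A).SmoothAt Z.quot (fun p => S.deltaAd p.1 p.2) (1, 1) := by
  obtain ⟨ω, ⟨-, -, U, hU, h1, hω⟩, hδ⟩ := S.outer
  refine ((smoothAt_mk Z _).comp (hω.smoothAt hU h1)).congr (Eventually.of_forall fun p => ?_)
  exact deltaAd_eq hδ _ _

/-- The form in which strong smoothness enters the construction of the Lie group: this factor occurs
in conjugation by $(1,g)$. -/
theorem IsStronglySmooth.smoothAt_deltaAd (hS : S.IsStronglySmooth)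
    (Z : SplitLieSubgroup B (Subgroup.center N)) (g : G) :
    A.SmoothAt Z.quot (fun x => S.deltaAd g x * (S.deltaAd (g * x * g⁻¹) g)⁻¹) 1 := by
  obtain ⟨ω, ⟨-, hω⟩, hδ⟩ := hS
  obtain ⟨U, hU, h1, hg⟩ := hω g
  refine ((smoothAt_mk Z _).comp (hg.smoothAt hU h1)).congr (Eventually.of_forall fun x => ?_)
  rw [deltaAd_eq hδ, deltaAd_eq hδ]
  rfl

/-! ### The equivalence relation on outer actions -/

/-- The cochain attached to `(C_N ∘ h) · S`. -/
theorem delta_of_equivalent {h : G → N} (hS' : ∀ g, S'.toFun g = MulAut.conj (h g) * S.toFun g)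
    {ω : G × G → N} (hω : ∀ g g', delta S.toFun g g' = MulAut.conj (ω (g, g'))) (g g' : G) :
    delta S'.toFun g g' =
      MulAut.conj (h g * S.toFun g (h g') * ω (g, g') * (h (g * g'))⁻¹) := by
  simp only [map_mul, map_inv, ← hω, mulAut_conj_apply_eq, delta, hS']
  group

/-- The cochain of `delta_of_equivalent` works. In $\omega'(g,x)\,\omega'(gxg^{-1},g)^{-1}$ the
factor $h(gx)$, which need not be smooth in $x$ near $1$, occurs twice and cancels. -/
theorem Equivalent.isStronglySmooth (hA : A.IsLieGroup) (hB : B.IsLieGroup)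
    (h : S.Equivalent S') (hS : S.IsStronglySmooth) : S'.IsStronglySmooth := by
  obtain ⟨h, ⟨h1, U, hU, h1U, hh⟩, hS'⟩ := h
  have hh1 : A.SmoothAt B h 1 := hh.smoothAt hU h1U
  obtain ⟨ω, ⟨⟨hω1, hω2, W, hW, h1W, hω⟩, hss⟩, hδ⟩ := hS
  have hω11 : (A.prod A).SmoothAt B ω (1, 1) := hω.smoothAt hW h1W
  refine ⟨fun p => h p.1 * S.toFun p.1 (h p.2) * ω p * (h (p.1 * p.2))⁻¹,
    ⟨⟨fun g => ?_, fun g => ?_, ?_⟩, fun g => ?_⟩, fun g g' => delta_of_equivalent hS' hδ g g'⟩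
  · simp [h1, S.normalized, hω1]
  · simp [h1, hω2]
  · have hf : (A.prod A).SmoothAt B (fun p => h p.1) (1, 1) := hh1.comp_of_eq smoothAt_fst rfl
    have hs : (A.prod A).SmoothAt B (fun p => h p.2) (1, 1) := hh1.comp_of_eq smoothAt_snd rfl
    have hm : (A.prod A).SmoothAt B (fun p => h (p.1 * p.2)) (1, 1) :=
      hh1.comp_of_eq (hA.mul smoothAt_fst smoothAt_snd) (one_mul 1)
    have hSh : (A.prod A).SmoothAt B (fun p => S.toFun p.1 (h p.2)) (1, 1) :=
      (S.smoothAt_toFun_one _).comp_of_eq (smoothAt_fst.prodMk hs) rfl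
    exact hB.mul (hB.mul (hB.mul hf hSh) hω11) (hB.inv hm)
  · obtain ⟨V, hV, h1V, hg⟩ := hss g
    have hc : A.SmoothAt A (fun x => g * x * g⁻¹) 1 :=
      hA.mul (hA.mul smoothAt_const smoothAt_id) smoothAt_const
    have hc1 : g * 1 * g⁻¹ = 1 := by simp
    have h₁ : A.SmoothAt B (fun x => h (g * x * g⁻¹)) 1 := hh1.comp_of_eq hc hc1
    have h₂ : A.SmoothAt B (fun x => S.toFun g (h x)) 1 := ((S.lieAut g).smoothAt _).comp hh1
    have h₃ : A.SmoothAt B (fun x => S.toFun (g * x * g⁻¹) (h g)) 1 :=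
      (S.smoothAt_toFun_one (h g)).comp_of_eq (hc.prodMk smoothAt_const)
        (by simp)
    -- What remains after the cancellation: `h` is evaluated only near `1` or at the constant `g`,
    -- and $S$ only near `1` or as the fixed automorphism $S(g)$.
    have h₄ : A.SmoothAt B (fun x => h g * S.toFun g (h x) *
        (ω (g, x) * (ω (g * x * g⁻¹, g))⁻¹) * (S.toFun (g * x * g⁻¹) (h g))⁻¹ *
        (h (g * x * g⁻¹))⁻¹) 1 :=
      hB.mul (hB.mul (hB.mul (hB.mul smoothAt_const h₂) (hg.smoothAt hV h1V)) (hB.inv h₃))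
        (hB.inv h₁)
    refine h₄.congr (Eventually.of_forall fun x => ?_)
    simp only [inv_mul_cancel_right]
    group

namespace GS

/-! ### The group `G^S` -/

/-- The homomorphism `(C_N(n), g) ↦ C_N(n) S(g)`. -/
noncomputable def toAut (S : SmoothOuterAction A B) : S.GS →* MulAut N where
  toFun x := conjAd x.ad * S.toFun x.base
  map_one' := by simp [one_def, S.normalized]
  map_mul' := conjAd_mul

theorem toAut_apply (x : S.GS) : toAut S x = conjAd x.ad * S.toFun x.base := rfl

theorem proj_apply (x : S.GS) : proj S x = x.base := rfl

/-- The faithful representation of $G^S$ in $\mathrm{Aut}(N)\times G$, used for the algebraic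
identities below. -/
theorem ext_toAut {x y : S.GS} (hb : x.base = y.base) (h : toAut S x = toAut S y) : x = y :=
  ext_conjAd hb h

theorem toAut_mk_coe (n : N) (g : G) :
    toAut S ⟨(n : N ⧸ Subgroup.center N), g⟩ = MulAut.conj n * S.toFun g := rfl

theorem toAut_incl (a : N ⧸ Subgroup.center N) : toAut S (incl S a) = conjAd a := by
  rw [toAut_apply]
  change conjAd a * S.toFun 1 = _
  rw [S.normalized, mul_one]

theorem toAut_one_mk (g : G) : toAut S ⟨1, g⟩ = S.toFun g := by
  rw [toAut_apply, map_one, one_mul]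

theorem mk_eq_incl_mul (a : N ⧸ Subgroup.center N) (g : G) :
    (⟨a, g⟩ : S.GS) = incl S a * ⟨1, g⟩ :=
  ext_toAut (one_mul g).symm (by rw [map_mul, toAut_incl, toAut_one_mk, toAut_apply])

theorem eq_incl_mul (x : S.GS) : x = incl S x.ad * ⟨1, x.base⟩ :=
  mk_eq_incl_mul x.ad x.base

theorem incl_injective : Function.Injective (incl S) := fun _ _ h => congrArg GS.ad h

theorem proj_eq_one_iff (x : S.GS) : proj S x = 1 ↔ ∃ a, x = incl S a :=
  ⟨fun h => ⟨x.ad, GS.ext rfl h⟩, by rintro ⟨a, rfl⟩; rfl⟩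

theorem incl_conj (a b : N ⧸ Subgroup.center N) (u : G) :
    incl S a * ⟨b, u⟩ * (incl S a)⁻¹ = ⟨a * b * S.actAd u a⁻¹, u⟩ := by
  rw [mul_inv_eq_iff_eq_mul]
  refine ext_toAut ?_ ?_
  · change 1 * u = u * 1
    simp
  · simp only [map_mul, toAut_incl]
    simp only [toAut_apply, map_mul, conjAd_actAd, map_inv]
    group

/-- Exhibits in coordinates why $C^2_{ss}$ is the right condition: besides $S(g)$ and conjugation in
$G$, only the factor controlled by strong smoothness appears. -/
theorem one_mk_conj (g u : G) (b : N ⧸ Subgroup.center N) :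
    (⟨1, g⟩ * ⟨b, u⟩ * (⟨1, g⟩)⁻¹ : S.GS) =
      ⟨S.actAd g b * (S.deltaAd g u * (S.deltaAd (g * u * g⁻¹) g)⁻¹), g * u * g⁻¹⟩ := by
  rw [mul_inv_eq_iff_eq_mul]
  refine ext_toAut ?_ ?_
  · change g * u = g * u * g⁻¹ * g
    simp
  · simp only [map_mul, map_inv, toAut_apply, conjAd_actAd, conjAd_deltaAd, map_one, delta,
      inv_mul_cancel_right]
    group

/-! ### Natural Lie group structures on $G^S$. -/

variable {L L' : LCManifold.{u₁, max u₂ u₃, v} 𝕜 S.GS}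

/-- A Lie group structure on `G^S` is natural if it is a product near the identity. -/
theorem IsNatural.of_smoothAt (hA : A.IsLieGroup)
    (hZ : Z.quot.IsLieGroup) (hL : L.IsLieGroup)
    (h₁ : (Z.quot.prod A).SmoothAt L (fun p => (⟨p.1, p.2⟩ : S.GS)) (1, 1))
    (h₂ : L.SmoothAt (Z.quot.prod A) (fun x => (x.ad, x.base)) 1) :
    IsNatural S Z.quot L := by
  have hincl : Z.quot.Smooth L (incl S) :=
    hZ.smooth_hom hL _ (h₁.comp_of_eq (smoothAt_id.prodMk smoothAt_const) rfl)
  have hproj : L.Smooth A (proj S) := hL.smooth_hom hA _ h₂.snd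
  have hsec : A.SmoothAt L (fun g => (⟨1, g⟩ : S.GS)) 1 :=
    h₁.comp_of_eq (smoothAt_const.prodMk smoothAt_id) rfl
  -- Over `U` the coordinate map is `(a, u) ↦ incl a * (1, u)`, smooth in all of $N_{\rm ad}$
  -- because `incl` is globally smooth.
  set U : Set G := {u | ∀ᶠ y in A.nhds u, A.SmoothAt L (fun g => (⟨1, g⟩ : S.GS)) y}
  have hU : A.IsOpenSet U := A.isOpenSet_setOf_eventually _
  have hUs : ∀ u ∈ U, A.SmoothAt L (fun g => (⟨1, g⟩ : S.GS)) u := fun u hu =>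
    eventually_self (p := fun y => A.SmoothAt L (fun g => (⟨1, g⟩ : S.GS)) y) hu
  refine ⟨hL, U, hU, hsec.eventually, hproj.isOpenSet_preimage hU,
    smoothOn_of_smoothAt ?_, smoothOn_of_smoothAt fun x hx => ?_⟩
  · rintro ⟨a, u⟩ ⟨-, hu⟩
    refine (hL.mul ((hincl.smoothAt a).comp_of_eq smoothAt_fst rfl)
      ((hUs u hu).comp_of_eq smoothAt_snd rfl)).congr (Eventually.of_forall fun p => ?_)
    exact mk_eq_incl_mul p.1 p.2
  · have hs : L.SmoothAt L (fun y => (⟨1, proj S y⟩ : S.GS)) x :=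
      (hUs (proj S x) hx).comp (hproj.smoothAt x)
    -- This product equals `incl (x.ad⁻¹ * y.ad)` and is `1` at `y = x`, so the coordinate `ad`,
    -- known to be smooth only near the identity, can be applied to it.
    have h₃ : L.SmoothAt L (fun y => (incl S x.ad)⁻¹ * (y * (⟨1, proj S y⟩ : S.GS)⁻¹)) x :=
      hL.mul smoothAt_const (hL.mul smoothAt_id (hL.inv hs))
    have hform : ∀ y : S.GS,
        (incl S x.ad)⁻¹ * (y * (⟨1, proj S y⟩ : S.GS)⁻¹) = incl S (x.ad⁻¹ * y.ad) := by
      intro y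
      rw [map_mul, map_inv]
      exact congrArg _ (mul_inv_eq_of_eq_mul (eq_incl_mul y))
    have h₄ := h₂.fst.comp_of_eq h₃ (by rw [hform, inv_mul_cancel, map_one])
    have h₅ : L.SmoothAt Z.quot (fun y => y.ad) x :=
      (hZ.mul (smoothAt_const (c := x.ad)) h₄).congr
        (Eventually.of_forall fun y => by rw [hform]; exact (mul_inv_cancel_left _ _).symm)
    exact h₅.prodMk (hproj.smoothAt x)

theorem IsNatural.smoothAt_mk {S : SmoothOuterAction A B}
    {L : LCManifold.{u₁, max u₂ u₃, v} 𝕜 S.GS} (h : IsNatural S Z.quot L)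
    (a : N ⧸ Subgroup.center N) :
    (Z.quot.prod A).SmoothAt L (fun p => (⟨p.1, p.2⟩ : S.GS)) (a, 1) := by
  obtain ⟨U, hU, h1, -, h₁, -⟩ := h.local_product
  exact h₁.smoothAt (isOpenSet_univ.prod hU) ⟨mem_univ _, h1⟩

theorem IsNatural.smoothAt_coords {S : SmoothOuterAction A B}
    {L : LCManifold.{u₁, max u₂ u₃, v} 𝕜 S.GS} (h : IsNatural S Z.quot L)
    {x : S.GS} (hx : x.base = 1) :
    L.SmoothAt (Z.quot.prod A) (fun x => (x.ad, x.base)) x := by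
  obtain ⟨U, -, h1, hU, -, h₂⟩ := h.local_product
  refine h₂.smoothAt hU ?_
  rw [mem_preimage, proj_apply, hx]
  exact h1

theorem IsNatural.smooth_incl (h : IsNatural S Z.quot L) (hZ : Z.quot.IsLieGroup) :
    Z.quot.Smooth L (incl S) :=
  hZ.smooth_hom h.lie _ ((h.smoothAt_mk 1).comp_of_eq (smoothAt_id.prodMk smoothAt_const) rfl)

theorem IsNatural.smooth_proj (h : IsNatural S Z.quot L) (hA : A.IsLieGroup) :
    L.Smooth A (proj S) :=
  h.lie.smooth_hom hA _ (h.smoothAt_coords rfl).snd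

theorem IsNatural.smoothAt_one_mk (h : IsNatural S Z.quot L) :
    A.SmoothAt L (fun g => (⟨1, g⟩ : S.GS)) 1 :=
  (h.smoothAt_mk 1).comp_of_eq (smoothAt_const.prodMk smoothAt_id) rfl

/-- The section is $g\mapsto(1,g)$ and the retraction is the coordinate `ad`, smooth along the whole
fibre over $1$ because the product structure holds on all of $N_{\rm ad}\times U$. -/
theorem IsNatural.isLieExtension (h : IsNatural S Z.quot L) (hA : A.IsLieGroup)
    (hZ : Z.quot.IsLieGroup) : IsLieExtension Z.quot L A (incl S) (proj S) where
  lie_kernel := hZ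
  lie_total := h.lie
  lie_base := hA
  bundle := isPrincipalBundle_of_section h.lie hA (h.smooth_incl hZ) (h.smooth_proj hA)
    incl_injective proj_eq_one_iff h.smoothAt_one_mk (fun _ => rfl) (r := GS.ad) (fun _ => rfl)
    fun _ => (h.smoothAt_coords rfl).fst

/-- Homomorphisms of the form `(a, g) ↦ (a h(g), g)` are smooth. -/
theorem IsNatural.smooth_hom {L' : LCManifold.{u₁, max u₂ u₃, v} 𝕜 S'.GS}
    (hn : IsNatural S Z.quot L) (hn' : IsNatural S' Z.quot L') (hZ : Z.quot.IsLieGroup)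
    (φ : S.GS →* S'.GS) {h : G → N ⧸ Subgroup.center N}
    (hh : A.SmoothAt Z.quot h 1) (hφ : ∀ x, φ x = ⟨x.ad * h x.base, x.base⟩) :
    L.Smooth L' φ := by
  refine hn.lie.smooth_hom hn'.lie φ ?_
  have hc := hn.smoothAt_coords (x := 1) rfl
  refine ((hn'.smoothAt_mk (1 * h 1)).comp_of_eq ((hZ.mul hc.fst (hh.comp_of_eq hc.snd rfl)).prodMk
    hc.snd) rfl).congr (Eventually.of_forall fun x => hφ x)

/-- The identity is a homomorphism of the form treated in `IsNatural.smooth_hom`, with constant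
$h=1$, in both directions. -/
theorem IsNatural.diffeo_refl (hn : IsNatural S Z.quot L) (hn' : IsNatural S Z.quot L')
    (hZ : Z.quot.IsLieGroup) : L.Diffeo L' (Equiv.refl S.GS) := by
  have hid : ∀ x : S.GS, MonoidHom.id S.GS x = ⟨x.ad * 1, x.base⟩ := fun x => by
    rw [mul_one]
    rfl
  exact ⟨hn.smooth_hom hn' hZ (MonoidHom.id _) smoothAt_const hid,
    hn'.smooth_hom hn hZ (MonoidHom.id _) smoothAt_const hid⟩

/-- `G^S` carries a natural Lie group structure. -/
theorem exists_isNatural (hA : A.IsLieGroup) (hB : B.IsLieGroup) (hZ : Z.quot.IsLieGroup)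
    (hS : S.IsStronglySmooth) :
    ∃ L : LCManifold.{u₁, max u₂ u₃, v} 𝕜 S.GS, IsNatural S Z.quot L := by
  -- `M` is the product manifold on all of $G^S$; it is only an auxiliary structure, correct near
  -- the identity.
  obtain ⟨M, hM, hM'⟩ := (Z.quot.prod A).exists_diffeo
    (⟨fun x => (x.ad, x.base), fun p => ⟨p.1, p.2⟩, fun _ => rfl, fun _ => rfl⟩ :
      S.GS ≃ (N ⧸ Subgroup.center N) × G)
  have had : ∀ x : S.GS, M.SmoothAt Z.quot (fun x => x.ad) x := fun x => (hM.smoothAt x).fst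
  have hbase : ∀ x : S.GS, M.SmoothAt A (fun x => x.base) x := fun x => (hM.smoothAt x).snd
  have hmk : ∀ p, (Z.quot.prod A).SmoothAt M (fun p => (⟨p.1, p.2⟩ : S.GS)) p :=
    fun p => hM'.smoothAt p
  have hact := fun a => S.smoothAt_actAd_one hB Z a
  have hδ := S.smoothAt_deltaAd Z
  have hmul : (M.prod M).SmoothAt M (fun p => p.1 * p.2) ((1, 1) : S.GS × S.GS) := by
    have hx : (M.prod M).SmoothAt M (fun p => p.1) ((1, 1) : S.GS × S.GS) := smoothAt_fst
    have hy : (M.prod M).SmoothAt M (fun p => p.2) ((1, 1) : S.GS × S.GS) := smoothAt_snd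
    have hxb := (hbase 1).comp_of_eq hx rfl
    have hyb := (hbase 1).comp_of_eq hy rfl
    exact (hmk _).comp ((hZ.mul (hZ.mul ((had 1).comp_of_eq hx rfl)
      ((hact 1).comp_of_eq (hxb.prodMk ((had 1).comp_of_eq hy rfl)) rfl))
      (hδ.comp_of_eq (hxb.prodMk hyb) rfl)).prodMk (hA.mul hxb hyb))
  have hinv : M.SmoothAt M (fun x => x⁻¹) (1 : S.GS) := by
    have hb := hA.inv (hbase (1 : S.GS))
    have hb1 : ((1 : S.GS).base)⁻¹ = 1 := inv_one
    exact (hmk _).comp ((hZ.mul (hZ.inv (hδ.comp_of_eq (hb.prodMk (hbase 1))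
      (Prod.ext hb1 rfl))) (hZ.inv ((hact 1).comp_of_eq (hb.prodMk (had 1))
      (Prod.ext hb1 rfl)))).prodMk hb)
  -- Each `k` is `incl a * (1, g)`, so its conjugation is a composite. The first factor needs $S$
  -- only near $1$; the second needs strong smoothness.
  have hconj : ∀ k : S.GS, M.SmoothAt M (fun x => k * x * k⁻¹) 1 := by
    have hincl : ∀ a, M.SmoothAt M (fun x => incl S a * x * (incl S a)⁻¹) 1 := fun a => by
      refine ((hmk _).comp ((hZ.mul (hZ.mul smoothAt_const (had 1))
        ((hact a⁻¹).comp_of_eq ((hbase 1).prodMk smoothAt_const) rfl)).prodMk (hbase 1))).congr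
        (Eventually.of_forall fun x => incl_conj a x.ad x.base)
    have hsec : ∀ g, M.SmoothAt M (fun x => ⟨1, g⟩ * x * (⟨1, g⟩ : S.GS)⁻¹) 1 := fun g => by
      refine ((hmk _).comp ((hZ.mul ((S.smoothAt_actAd hB Z g _).comp (had 1))
        ((hS.smoothAt_deltaAd Z g).comp_of_eq (hbase 1) rfl)).prodMk
        (hA.mul (hA.mul smoothAt_const (hbase 1)) smoothAt_const))).congr
        (Eventually.of_forall fun x => one_mk_conj g x.base x.ad)
    intro k
    refine ((hincl k.ad).comp_of_eq (hsec k.base) (by group)).congr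
      (Eventually.of_forall fun x => ?_)
    conv_lhs => rw [eq_incl_mul k]
    group
  obtain ⟨L, hL, h₁, h₂⟩ := M.exists_isLieGroup hmul hinv hconj
  exact ⟨L, .of_smoothAt hA hZ hL (h₁.comp_of_eq (hmk (1, 1)) rfl)
    ((hM.smoothAt 1).comp_of_eq h₂ rfl)⟩

/-- Equivalent outer actions give equivalent extensions. -/
theorem IsNatural.extensionEquivalent {L' : LCManifold.{u₁, max u₂ u₃, v} 𝕜 S'.GS}
    (hn : IsNatural S Z.quot L) (hn' : IsNatural S' Z.quot L') (hZ : Z.quot.IsLieGroup)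
    (h : S.Equivalent S') :
    ExtensionEquivalent L' L (incl S') (proj S') (incl S) (proj S) := by
  obtain ⟨h, ⟨h1, U, hU, h1U, hh⟩, hS'⟩ := h
  let f : S'.GS → S.GS := fun x => ⟨x.ad * (h x.base : N ⧸ Subgroup.center N), x.base⟩
  -- The map `f` preserves both the automorphism of $N$ and the base point, hence is multiplicative.
  have hf : ∀ x, toAut S (f x) = toAut S' x := fun x => by
    rw [toAut_apply, toAut_apply, hS', map_mul, mul_assoc]
    rfl
  let φ : S'.GS →* S.GS :=
    { toFun := f
      map_one' := ext_toAut rfl (by rw [hf, map_one, map_one])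
      map_mul' := fun x y => ext_toAut rfl (by rw [hf, map_mul, map_mul, hf, hf]) }
  refine ⟨φ, hn'.smooth_hom hn hZ φ ((SmoothOuterAction.smoothAt_mk Z _).comp (hh.smoothAt hU h1U))
    (fun _ => rfl), fun a => ?_, fun _ => rfl⟩
  refine GS.ext ?_ rfl
  change a * (h 1 : N ⧸ Subgroup.center N) = a
  rw [h1, QuotientGroup.mk_one, mul_one]

/-- The action of `G^S` on `N` is smooth. -/
theorem IsNatural.isSmoothAction (hn : IsNatural S Z.quot L) (hB : B.IsLieGroup) :
    IsSmoothAction L B (toAut S) := by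
  have haut : ∀ x, IsLieAut B (toAut S x) := fun x => by
    obtain ⟨a, g⟩ := x
    induction a using QuotientGroup.induction_on with | H n => ?_
    rw [toAut_mk_coe]
    exact (isLieAut_conj hB n).mul (S.lieAut g)
  refine ⟨haut, smooth_of_smoothAt ?_⟩
  rintro ⟨x, n⟩
  -- Writing $\rho(y)=\rho(x)\rho(x^{-1}y)$ leaves one fixed automorphism and the action of elements
  -- near the identity, where coordinates are available.
  have hx : (L.prod B).SmoothAt L (fun p => x⁻¹ * p.1) (x, n) :=
    hn.lie.mul smoothAt_const smoothAt_fst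
  have hc := (hn.smoothAt_coords (x := 1) rfl).comp_of_eq hx (inv_mul_cancel x)
  have h₁ : (L.prod B).SmoothAt B (fun p => S.toFun (x⁻¹ * p.1).base p.2) (x, n) :=
    (S.smoothAt_toFun_one n).comp_of_eq (hc.snd.prodMk smoothAt_snd)
      (Prod.ext (congrArg GS.base (inv_mul_cancel x)) rfl)
  have h₂ := (smoothAt_conjAd hB Z _).comp (hc.fst.prodMk h₁)
  refine (((haut x).smoothAt _).comp h₂).congr (Eventually.of_forall fun p => ?_)
  change toAut S p.1 p.2 = (toAut S x * toAut S (x⁻¹ * p.1)) p.2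
  rw [← map_mul, mul_inv_cancel_left]

end GS

end SmoothOuterAction

end OuterActions

/-! ## The crossed module -/

section CrossedModule

open LCManifold

variable {𝕜 : Type u₁} [RCLike 𝕜]

section Diffeo

universe w₁ w₂ w₃
variable {M₁ : Type w₁} {M₂ : Type w₂} {M₃ : Type w₃} {A : LCManifold.{u₁, w₁, v} 𝕜 M₁}
  {B : LCManifold.{u₁, w₂, v} 𝕜 M₂} {C : LCManifold.{u₁, w₃, v} 𝕜 M₃}

theorem LCManifold.Diffeo.symm {e : M₁ ≃ M₂} (h : A.Diffeo B e) : B.Diffeo A e.symm :=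
  ⟨h.2, h.1⟩

theorem LCManifold.Diffeo.trans {e : M₁ ≃ M₂} {e' : M₂ ≃ M₃} (h : A.Diffeo B e)
    (h' : B.Diffeo C e') : A.Diffeo C (e.trans e') :=
  ⟨smooth_of_smoothAt fun x => (h'.1.smoothAt _).comp (h.1.smoothAt x),
    smooth_of_smoothAt fun x => (h.2.smoothAt _).comp (h'.2.smoothAt x)⟩

end Diffeo

section Extension

/-! ### Kernel and cokernel of a Lie group extension. -/

variable {N : Type u₂} [Group N] {P : Type u₃} [Group P] {G : Type u₄} [Group G]
  {A : LCManifold.{u₁, u₂, v} 𝕜 N} {B : LCManifold.{u₁, u₃, v} 𝕜 P}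
  {C : LCManifold.{u₁, u₄, v} 𝕜 G} {i : N →* P} {q : P →* G}

theorem IsLieExtension.map_eq_one_iff (h : IsLieExtension A B C i q) (p : P) :
    q p = 1 ↔ ∃ n, i n = p := by
  rw [← map_one q, eq_comm, h.bundle.fiber]
  simp only [one_mul, eq_comm]

theorem IsLieExtension.surjective (h : IsLieExtension A B C i q) : Function.Surjective q :=
  fun x => by
    obtain ⟨V, -, hx, s, -, hs, -⟩ := h.bundle.locally_trivial x
    exact ⟨s x, hs x hx⟩

/-- The kernel of an extension is a split Lie subgroup. -/
theorem IsLieExtension.exists_splitLieSubgroup (h : IsLieExtension A B C i q) {R : Subgroup P}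
    (hR : R = q.ker) : ∃ (I : SplitLieSubgroup B R) (e : R ≃* N),
      (∀ x, i (e x) = x) ∧ I.sub.Diffeo A e.toEquiv := by
  subst hR
  have hmem : ∀ n, i n ∈ q.ker := fun n => (h.map_eq_one_iff _).2 ⟨n, rfl⟩
  let e : q.ker ≃* N := (MulEquiv.ofBijective (i.codRestrict q.ker hmem)
    ⟨fun x y hxy => h.bundle.free (congrArg Subtype.val hxy), fun x => by
      obtain ⟨n, hn⟩ := (h.map_eq_one_iff _).1 x.2
      exact ⟨n, Subtype.ext hn⟩⟩).symm
  have he : ∀ x, i (e x) = x := fun x => congrArg Subtype.val (e.symm_apply_apply x)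
  let f : P ⧸ q.ker ≃* G := QuotientGroup.quotientKerEquivOfSurjective q h.surjective
  obtain ⟨A', hA'⟩ := A.exists_diffeo e.toEquiv
  obtain ⟨C', hC'⟩ := C.exists_diffeo f.toEquiv
  exact ⟨⟨A', h.lie_kernel.of_diffeo e hA', C', h.bundle.transport e hA' f.toEquiv hC'
    (fun x => (he x).symm) fun _ => rfl⟩, e, he, hA'⟩

/-- The cokernel of the inclusion of an extension is the base. -/
theorem IsLieExtension.exists_quotient_equiv (h : IsLieExtension A B C i q) {R : Subgroup P}
    (hR : R = q.ker) : ∃ (_ : R.Normal) (e : P ⧸ R ≃* G),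
      (∀ x : P, e (x : P ⧸ R) = q x) ∧
        ∀ I : SplitLieSubgroup B R, I.quot.Diffeo C e.toEquiv := by
  subst hR
  refine ⟨inferInstance, QuotientGroup.quotientKerEquivOfSurjective q h.surjective,
    fun _ => rfl, fun I => I.bundle.diffeo_base h.lie_total h.bundle _ fun _ => rfl⟩

end Extension

namespace SmoothOuterAction.GS

variable {G : Type u₂} [Group G] {N : Type u₃} [Group N]
  {A : LCManifold.{u₁, u₂, v} 𝕜 G} {B : LCManifold.{u₁, u₃, v} 𝕜 N}
  {S : SmoothOuterAction A B} {Z : SplitLieSubgroup B (Subgroup.center N)}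
  {L : LCManifold.{u₁, max u₂ u₃, v} 𝕜 S.GS}

/-- The homomorphism `n ↦ (C_N(n), 1)`. -/
noncomputable def alpha (S : SmoothOuterAction A B) : N →* S.GS :=
  (incl S).comp (QuotientGroup.mk' (Subgroup.center N))

theorem alpha_apply (n : N) : alpha S n = ⟨(n : N ⧸ Subgroup.center N), 1⟩ := rfl

theorem toAut_alpha (n : N) : toAut S (alpha S n) = MulAut.conj n :=
  toAut_incl _

theorem ker_alpha : (alpha S).ker = Subgroup.center N := by
  ext n
  rw [MonoidHom.mem_ker, ← QuotientGroup.eq_one_iff, ← (incl_injective (S := S)).eq_iff, map_one]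
  rfl

theorem range_alpha : (alpha S).range = (incl S).range := by
  rw [alpha, MonoidHom.range_comp, QuotientGroup.range_mk', MonoidHom.range_eq_map]

theorem range_incl : (incl S).range = (proj S).ker := by
  ext x
  rw [MonoidHom.mem_range, MonoidHom.mem_ker, proj_eq_one_iff]
  simp only [eq_comm]

/-- The algebraic axioms hold after applying `toAut`, where they say $C_N(f(n))=fC_N(n)f^{-1}$. The
splitting of the image comes from the extension, that of the kernel from $Z(N)$. -/
theorem IsNatural.isSmoothCrossedModule (hn : IsNatural S Z.quot L) (hA : A.IsLieGroup)
    (hB : B.IsLieGroup) (hZ : Z.quot.IsLieGroup) :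
    IsSmoothCrossedModule B L (alpha S) (toAut S) where
  lie_source := hB
  lie_target := hn.lie
  smooth := smooth_of_smoothAt fun n =>
    ((hn.smooth_incl hZ).smoothAt _).comp (SmoothOuterAction.smoothAt_mk Z n)
  action := hn.isSmoothAction hB
  equivariant x n := by
    rw [eq_mul_inv_iff_mul_eq]
    refine ext_toAut ?_ ?_
    · change 1 * x.base = x.base * 1
      rw [one_mul, mul_one]
    · rw [map_mul, map_mul, toAut_alpha, toAut_alpha, mulAut_conj_apply_eq,
        inv_mul_cancel_right]
  peiffer := toAut_alpha
  split := by
    obtain ⟨I, e, he, hI⟩ := (hn.isLieExtension hA hZ).exists_splitLieSubgroup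
      (range_alpha.trans range_incl)
    obtain ⟨K⟩ : Nonempty (SplitLieSubgroup B (alpha S).ker) := by
      rw [ker_alpha]
      exact ⟨Z⟩
    refine ⟨K, I, ?_⟩
    set f := (QuotientGroup.quotientKerEquivRange (alpha S)).toEquiv
    -- `K` was obtained by rewriting the kernel as the center, without recording its relation to
    -- `Z`. Both quotients are bases of principal bundles with total space $N$ and corresponding
    -- fibres, which makes the bijection a diffeomorphism.
    have hK : K.quot.Diffeo Z.quot (f.trans e.toEquiv) := by
      refine K.bundle.diffeo_base hB Z.bundle _ fun n => incl_injective (S := S) ?_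
      exact he (f (n : N ⧸ (alpha S).ker))
    have hf : f = (f.trans e.toEquiv).trans e.toEquiv.symm := by
      rw [Equiv.trans_assoc, Equiv.self_trans_symm, Equiv.trans_refl]
    rw [hf]
    exact hK.trans hI.symm

/-- `α ∘ ω = δ_σ` for the section `σ(g) = (1, g)` of `q_S`. -/
theorem alpha_eq_delta {ω : G × G → N}
    (hω : ∀ g g', delta S.toFun g g' = MulAut.conj (ω (g, g'))) (g g' : G) :
    alpha S (ω (g, g')) = delta (fun g => (⟨1, g⟩ : S.GS)) g g' := by
  rw [delta, eq_mul_inv_iff_mul_eq]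
  refine ext_toAut ?_ ?_
  · change 1 * (g * g') = g * g'
    rw [one_mul]
  · simp only [map_mul, toAut_alpha, toAut_one_mk, ← hω, delta, inv_mul_cancel_right]

theorem mk_mul_mk {ω : G × G → N}
    (hω : ∀ g g', delta S.toFun g g' = MulAut.conj (ω (g, g'))) (n n' : N) (g g' : G) :
    (⟨(n : N ⧸ Subgroup.center N), g⟩ * ⟨(n' : N ⧸ Subgroup.center N), g'⟩ : S.GS) =
      ⟨((n * S.toFun g n' * ω (g, g') : N) : N ⧸ Subgroup.center N), g * g'⟩ := by
  rw [mul_def, deltaAd_eq hω]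
  rfl

end SmoothOuterAction.GS

end CrossedModule

theorem mainTheorem6 {𝕜 : Type u₁} [RCLike 𝕜]
    {G : Type u₂} [Group G] (MG : LCManifold.{u₁, u₂, v} 𝕜 G) (hG : MG.IsLieGroup)
    {N : Type u₃} [Group N] (MN : LCManifold.{u₁, u₃, v} 𝕜 N) (hN : MN.IsLieGroup)
    (Z : SplitLieSubgroup MN (Subgroup.center N))
    (S : SmoothOuterAction MG MN) (hS : S.IsStronglySmooth) :
    -- the quotient manifold structure makes `N_ad = N ⧸ Z(N)` a Lie group
    Z.quot.IsLieGroup ∧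
    -- the product of `G^S`, for every `ω` with `δ_S = C_N ∘ ω`
    (∀ ω : G × G → N, (∀ g g', delta S.toFun g g' = MulAut.conj (ω (g, g'))) →
      ∀ (n n' : N) (g g' : G),
        (⟨(n : N ⧸ Subgroup.center N), g⟩ * ⟨(n' : N ⧸ Subgroup.center N), g'⟩ : S.GS) =
          ⟨((n * S.toFun g n' * ω (g, g') : N) : N ⧸ Subgroup.center N), g * g'⟩) ∧
    -- (1) the natural Lie group structure, and the extension
    ∃ L : LCManifold.{u₁, max u₂ u₃, v} 𝕜 S.GS,
      SmoothOuterAction.GS.IsNatural S Z.quot L ∧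
      (∀ L' : LCManifold.{u₁, max u₂ u₃, v} 𝕜 S.GS,
        SmoothOuterAction.GS.IsNatural S Z.quot L' → L.Diffeo L' (Equiv.refl S.GS)) ∧
      IsLieExtension Z.quot L MG
        (SmoothOuterAction.GS.incl S) (SmoothOuterAction.GS.proj S) ∧
      -- its equivalence class depends only on the class of `S`
      (∀ S' : SmoothOuterAction MG MN, S.Equivalent S' →
        S'.IsStronglySmooth ∧
        ∀ L' : LCManifold.{u₁, max u₂ u₃, v} 𝕜 S'.GS,
          SmoothOuterAction.GS.IsNatural S' Z.quot L' →
          ExtensionEquivalent L' L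
            (SmoothOuterAction.GS.incl S') (SmoothOuterAction.GS.proj S')
            (SmoothOuterAction.GS.incl S) (SmoothOuterAction.GS.proj S)) ∧
      -- (2) the smooth action of `G^S` on `N`
      ∃ ρ : S.GS →* MulAut N,
        (∀ (n : N) (g : G),
          ρ ⟨(n : N ⧸ Subgroup.center N), g⟩ = MulAut.conj n * S.toFun g) ∧
        IsSmoothAction L MN ρ ∧
        -- (3) the crossed module, its kernel and its cokernel
        ∃ α : N →* S.GS,
          (∀ n : N, α n = ⟨(n : N ⧸ Subgroup.center N), 1⟩) ∧
          IsSmoothCrossedModule MN L α ρ ∧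
          α.ker = Subgroup.center N ∧
          α.range = (SmoothOuterAction.GS.incl S).range ∧
          (∃ (_ : α.range.Normal) (e : S.GS ⧸ α.range ≃* G),
            (∀ x : S.GS, e (x : S.GS ⧸ α.range) = SmoothOuterAction.GS.proj S x) ∧
            ∀ I : SplitLieSubgroup L α.range, I.quot.Diffeo MG e.toEquiv) ∧
          -- `S` is the outer action obtained from the crossed module and a section `σ`
          ∃ σ : G → S.GS, IsCochain₁ MG L σ ∧
            (∀ g, SmoothOuterAction.GS.proj S (σ g) = g) ∧
            (∀ g, ρ (σ g) = S.toFun g) ∧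
            ∃ ω : G × G → N, IsCochain₂ss MG MN ω ∧
              (∀ g g', α (ω (g, g')) = delta σ g g') ∧
              ∀ g g', delta S.toFun g g' = MulAut.conj (ω (g, g')) := by
  have hZ := Z.quot_isLieGroup hN
  obtain ⟨L, hL⟩ := SmoothOuterAction.GS.exists_isNatural hG hN hZ hS
  have hext := hL.isLieExtension hG hZ
  refine ⟨hZ, fun ω hω => SmoothOuterAction.GS.mk_mul_mk hω, L, hL,
    fun L' hL' => hL.diffeo_refl hL' hZ, hext,
    fun S' hS' => ⟨hS'.isStronglySmooth hG hN hS, fun L' hL' => hL.extensionEquivalent hL' hZ hS'⟩,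
    SmoothOuterAction.GS.toAut S, SmoothOuterAction.GS.toAut_mk_coe, hL.isSmoothAction hN,
    SmoothOuterAction.GS.alpha S, SmoothOuterAction.GS.alpha_apply,
    hL.isSmoothCrossedModule hG hN hZ, SmoothOuterAction.GS.ker_alpha,
    SmoothOuterAction.GS.range_alpha,
    hext.exists_quotient_equiv
      (SmoothOuterAction.GS.range_alpha.trans SmoothOuterAction.GS.range_incl),
    -- The section is $\sigma(g)=(1,g)$. The relation $\alpha\circ\omega=\delta_\sigma$ holds for
    -- every $\omega$ representing $\delta_S$, so the one provided by strong smoothness can be used.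
    fun g => ⟨1, g⟩, ⟨rfl, hL.smoothAt_one_mk⟩, fun _ => rfl,
    SmoothOuterAction.GS.toAut_one_mk, ?_⟩
  obtain ⟨ω, hω, hδ⟩ := hS
  exact ⟨ω, hω, SmoothOuterAction.GS.alpha_eq_delta hδ, hδ⟩
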